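/- Let $k$ be a field and let $R=k[x_1,\dots,x_a]$, $S=k[y_1,\dots,y_b]$ be standard graded polynomial rings with $a,b\ge 1$ and graded maximal ideals $\mathfrak m\subseteq R$, $\mathfrak n\subseteq S$. Let $I\subseteq\mathfrak m^2$ and $J\subseteq\mathfrak n^2$ be homogeneous ideals of $R$ and $S$, and let $T=R\otimes_k S$. We write $I,J,\mathfrak m,\mathfrak n$ also for the extensions of these ideals to $T$. Put $F=I+J+\mathfrak m\mathfrak n$ (the fiber product of $I$ and $J$) and $H=I+\mathfrak m\mathfrak n$. Let $s\ge 1$ be an integer, and for $0\le t\le s$ put $$G_t=H^s+\sum_{i=1}^{t}(\mathfrak m\mathfrak n)^{s-i}J^i,\qquad\text{so that } G_0=H^s .$$ For an ideal $P$ of $T$ let $\beta_i(P)=\dim_k\operatorname{Tor}^T_i(k,P)$ with $k=T/(\mathfrak m+\mathfrak n)$, and $\beta_{-1}(P)=0$. A decomposition $P=A+B$, where $P,A,B$ are non-zero proper ideals of $T$, is called a Betti splitting if $\beta_i(P)=\beta_i(A)+\beta_i(B)+\beta_{i-1}(A\cap B)$ for all $i\ge 0$. A homogeneous ideal $M$ of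 $S$ is called Koszul if its linearity defect is $0$, that is, if, for the minimal graded free resolution $X$ of $M$ with the subcomplexes $\mathcal F^qX$ given by $(\mathcal F^qX)_i=\mathfrak n^{\max(q-i,0)}X_i$, the linear part $\bigoplus_{q\ge 0}\mathcal F^qX/\mathcal F^{q+1}X$ has zero homology in all homological degrees $i\ge 1$. Then the following hold. (1) $F^s=H^s+\sum_{i=1}^s(\mathfrak m\mathfrak n)^{s-i}J^i$. (2) For every $1\le t\le s$, $\;G_{t-1}\cap(\mathfrak m\mathfrak n)^{s-t}J^t=\mathfrak m^{s-t+1}\mathfrak n^{s-t}J^t$. (3) Assume that one of the following conditions holds: (i) $\operatorname{char}k=0$; (ii) $J$ is a monomial ideal; (iii) $J^t$ is Koszul for all $1\le t\le s$. Then for every $1\le t\le s$ we have $G_t=G_{t-1}+(\mathfrak m\mathfrak n)^{s-t}J^t$, and $$\beta_i(G_t)=\beta_i(G_{t-1})+\beta_i\bigl((\mathfrak m\mathfrak n)^{s-t}J^t\bigr)+\beta_{i-1}\bigl(G_{t-1}\cap(\mathfrak m\mathfrak n)^{s-t}J^t\bigr)\quad\text{for all } i\ge 0 .$$ If moreover $J\ne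 0$, then the ideals $G_t$, $G_{t-1}$ and $(\mathfrak m\mathfrak n)^{s-t}J^t$ are non-zero and proper, so that the decomposition $G_t=G_{t-1}+(\mathfrak m\mathfrak n)^{s-t}J^t$ is a Betti splitting. -/

import Mathlib

open CategoryTheory
open scoped TensorProduct

attribute [local instance] MvPolynomial.gradedAlgebra

universe u

namespace FiberPowers

/-! ### Monomial ideals -/

/-- An ideal of a polynomial ring is monomial if it is generated by a set of monomials. -/
def IsMonomialIdeal {σ k : Type*} [Field k] (J : Ideal (MvPolynomial σ k)) : Prop :=
  ∃ A : Set (σ →₀ ℕ), J = Ideal.span ((fun a => MvPolynomial.monomial a (1 : k)) '' A)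

/-! ### Minimal graded free resolutions, linearity defect, Koszul ideals -/

/-- A minimal graded free resolution
`⋯ → X₁ → X₀ → M → 0` of an ideal `M` of the standard graded polynomial ring `S = k[σ]`, where
`X i = ⨁ p, S(-deg i p)` is free of finite rank `rank i`. -/
structure MinimalGradedFreeResolution {σ k : Type*} [Field k]
    (M : Ideal (MvPolynomial σ k)) where
  /-- the rank of `X i` -/
  rank : ℕ → ℕ
  /-- the degrees of the elements of the standard basis of `X i` -/
  deg : (i : ℕ) → Fin (rank i) → ℕ
  /-- the differential `X (i + 1) → X i` -/
  d : (i : ℕ) → (Fin (rank (i + 1)) → MvPolynomial σ k) →ₗ[MvPolynomial σ k]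
    (Fin (rank i) → MvPolynomial σ k)
  /-- the augmentation `X 0 → M ⊆ S` -/
  aug : (Fin (rank 0) → MvPolynomial σ k) →ₗ[MvPolynomial σ k] MvPolynomial σ k
  /-- the differentials are homogeneous of degree zero: the `(p, q)` entry of the matrix of `d i`
  is a form of degree `deg (i + 1) q - deg i p` (so it is zero if this number is negative) -/
  d_homogeneous : ∀ i q p, ∀ m ∈ (d i (Pi.single q 1) p).support,
    m.degree + deg i p = deg (i + 1) q
  /-- the augmentation is homogeneous of degree zero -/
  aug_homogeneous : ∀ p, (aug (Pi.single p 1)).IsHomogeneous (deg 0 p)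
  range_aug : LinearMap.range aug = M
  exact_zero : LinearMap.ker aug = LinearMap.range (d 0)
  exact_succ : ∀ i, LinearMap.ker (d i) = LinearMap.range (d (i + 1))
  /-- minimality: `d (X (i + 1)) ⊆ 𝔫 X i` for the graded maximal ideal `𝔫` of `S` -/
  minimal : ∀ i, LinearMap.range (d i) ≤
    MvPolynomial.idealOfVars σ k • (⊤ : Submodule (MvPolynomial σ k) _)

namespace MinimalGradedFreeResolution

variable {σ k : Type*} [Field k] {M : Ideal (MvPolynomial σ k)}
  (X : MinimalGradedFreeResolution M)

/-- The homological degree `i` part `𝔫 ^ (q - i) X i` of the subcomplex `ℱ^q X` of `X`; here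
`𝔫 ^ (q - i)` is the whole ring if `q ≤ i`, in agreement with the truncated subtraction. -/
noncomputable def filt (q i : ℕ) : Submodule (MvPolynomial σ k) (Fin (X.rank i) → MvPolynomial σ k) :=
  (MvPolynomial.idealOfVars σ k ^ (q - i)) • ⊤

/-- The elements of `(ℱ^q X) i` whose classes are cycles of `ℱ^q X / ℱ^(q+1) X`. -/
noncomputable def linCycles (q : ℕ) :
    (i : ℕ) → Submodule (MvPolynomial σ k) (Fin (X.rank i) → MvPolynomial σ k)
  | 0 => X.filt q 0
  | i + 1 => X.filt q (i + 1) ⊓ (X.filt (q + 1) i).comap (X.d i)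

/-- The elements of `(ℱ^q X) i` whose classes are boundaries of `ℱ^q X / ℱ^(q+1) X`. -/
noncomputable def linBoundaries (q i : ℕ) :
    Submodule (MvPolynomial σ k) (Fin (X.rank i) → MvPolynomial σ k) :=
  (X.filt q (i + 1)).map (X.d i) ⊔ X.filt (q + 1) i

/-- `H_i (lin X) = 0`, where the linear part `lin X` of `X` is the direct sum of the complexes
`ℱ^q X / ℱ^(q+1) X` over all `q`. -/
def LinHomologyVanishes (i : ℕ) : Prop :=
  ∀ q, X.linCycles q i ≤ X.linBoundaries q i

/-- `sup {i | H_i (lin X) ≠ 0}`, the linearity defect of the resolved ideal (with value `0` for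
the zero ideal, whose minimal resolution is zero). -/
noncomputable def linearityDefect : ℕ∞ :=
  ⨆ i ∈ {i : ℕ | ¬ X.LinHomologyVanishes i}, (i : ℕ∞)

end MinimalGradedFreeResolution

/-- A homogeneous ideal `M` of a standard graded polynomial ring is Koszul if its linearity defect
is zero. The linearity defect is computed from a minimal graded free resolution of `M`, which is
unique up to isomorphism. -/
def IsKoszulIdeal {σ k : Type*} [Field k] (M : Ideal (MvPolynomial σ k)) : Prop :=
  ∃ X : MinimalGradedFreeResolution M, X.linearityDefect = 0

/-! ### Betti numbers and Betti splittings -/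

section Betti

variable (k : Type*) {T : Type u} [Field k] [CommRing T] [Algebra k T]

/-- The Betti number `β_i(M) = dim_k Tor_i^T(k, M)` of an ideal `M` of the `k`-algebra `T`, where
`k` is regarded as the `T`-module `T ⧸ 𝔐`. -/
noncomputable def bettiNumber (𝔐 : Ideal T) (i : ℕ) (M : Ideal T) : Cardinal :=
  Module.rank k (RestrictScalars k T
    (((Tor (ModuleCat.{u} T) i).obj (ModuleCat.of T (T ⧸ 𝔐))).obj (ModuleCat.of T M)))

/-- `β_i(P) = β_i(A) + β_i(B) + β_{i-1}(A ∩ B)` for all `i ≥ 0`, where `β_{-1} = 0`. -/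
def BettiNumbersSplit (𝔐 P A B : Ideal T) : Prop :=
  bettiNumber k 𝔐 0 P = bettiNumber k 𝔐 0 A + bettiNumber k 𝔐 0 B ∧
  ∀ i : ℕ, bettiNumber k 𝔐 (i + 1) P =
    bettiNumber k 𝔐 (i + 1) A + bettiNumber k 𝔐 (i + 1) B + bettiNumber k 𝔐 i (A ⊓ B)

/-- The decomposition `P = A + B` of a non-zero proper ideal as a sum of two non-zero proper ideals
is a Betti splitting. -/
structure IsBettiSplitting (𝔐 P A B : Ideal T) : Prop where
  ne_bot : P ≠ ⊥ ∧ A ≠ ⊥ ∧ B ≠ ⊥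
  ne_top : P ≠ ⊤ ∧ A ≠ ⊤ ∧ B ≠ ⊤
  eq_add : P = A + B
  betti : BettiNumbersSplit k 𝔐 P A B

end Betti

/-! ### The fiber product of two ideals -/

section FiberProduct

variable {k σ τ : Type*} [Field k]

/-- The extension to `T = R ⊗ S` of an ideal of `R = k[σ]`. -/
noncomputable def extLeft (τ : Type*) (I : Ideal (MvPolynomial σ k)) :
    Ideal (MvPolynomial σ k ⊗[k] MvPolynomial τ k) :=
  I.map (Algebra.TensorProduct.includeLeft :
    MvPolynomial σ k →ₐ[k] MvPolynomial σ k ⊗[k] MvPolynomial τ k)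

/-- The extension to `T = R ⊗ S` of an ideal of `S = k[τ]`. -/
noncomputable def extRight (σ : Type*) (J : Ideal (MvPolynomial τ k)) :
    Ideal (MvPolynomial σ k ⊗[k] MvPolynomial τ k) :=
  J.map (Algebra.TensorProduct.includeRight :
    MvPolynomial τ k →ₐ[k] MvPolynomial σ k ⊗[k] MvPolynomial τ k)

variable (k σ τ) in
/-- The extension to `T` of the graded maximal ideal of `R`. -/
noncomputable def maxLeft : Ideal (MvPolynomial σ k ⊗[k] MvPolynomial τ k) :=
  extLeft τ (MvPolynomial.idealOfVars σ k)

variable (k σ τ) in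
/-- The extension to `T` of the graded maximal ideal of `S`. -/
noncomputable def maxRight : Ideal (MvPolynomial σ k ⊗[k] MvPolynomial τ k) :=
  extRight σ (MvPolynomial.idealOfVars τ k)

/-- `F = I + J + 𝔪𝔫`, the fiber product of `I` and `J`. -/
noncomputable def fiberProduct (I : Ideal (MvPolynomial σ k)) (J : Ideal (MvPolynomial τ k)) :
    Ideal (MvPolynomial σ k ⊗[k] MvPolynomial τ k) :=
  extLeft τ I + extRight σ J + maxLeft k σ τ * maxRight k σ τ

/-- `H = I + 𝔪𝔫`. -/
noncomputable def idealH (τ : Type*) (I : Ideal (MvPolynomial σ k)) :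
    Ideal (MvPolynomial σ k ⊗[k] MvPolynomial τ k) :=
  extLeft τ I + maxLeft k σ τ * maxRight k σ τ

/-- `G_t = H ^ s + ∑_{i=1}^t (𝔪𝔫)^(s-i) J^i`, used for `0 ≤ t ≤ s`; in particular `G_0 = H ^ s`. -/
noncomputable def idealG (I : Ideal (MvPolynomial σ k)) (J : Ideal (MvPolynomial τ k)) (s t : ℕ) :
    Ideal (MvPolynomial σ k ⊗[k] MvPolynomial τ k) :=
  idealH τ I ^ s +
    ∑ i ∈ Finset.Icc 1 t, (maxLeft k σ τ * maxRight k σ τ) ^ (s - i) * extRight σ J ^ i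

end FiberProduct

end FiberPowers

-- Statement (1) is ideal arithmetic: `I * J` lies in `(𝔪𝔫)^2`, so every mixed product of `I` and
-- `J` is absorbed by terms already on the right. For (2), put `p = s - t`. The ideal `G_{t-1}` lies
-- in `𝔪^(p+1)`. The variables generating `𝔪` are independent of those of `S`, so intersecting
-- `𝔪^(p+1)` with the extension of an ideal of `S` amounts to multiplying by it. Conversely, `J ⊆
-- 𝔫^2` puts `𝔪^(p+1) 𝔫^p J^t` inside `(𝔪𝔫)^(p+1) J^(t-1)`, which is contained in `G_{t-1}`.
--
-- For (3), the long exact Tor sequence of `0 → A ∩ B → A ⊕ B → A + B → 0` splits into short exact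
-- pieces as soon as both inclusions of `A ∩ B` induce zero on `Tor(k, -)`. Tor is computed by the
-- Koszul complex on all the variables (`nonempty_tor_equiv_koszulH`): dimension shifting along a
-- projective resolution identifies both theories with the same subquotient. "Zero on Tor" then
-- reads "every Koszul cycle with coefficients in `U` bounds a chain with coefficients in `V`", the
-- form `koszulZ _ _ a U ≤ koszulB _ _ a V`, and `bettiNumbersSplit_of_koszul` turns two such
-- inclusions into the equality of Betti numbers.
--
-- The inclusion `𝔪^(p+1) 𝔫^p J^t → 𝔪^p 𝔫^p J^t` is handled by dividing by the variables of `R`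
-- (`koszulZ_le_koszulB_sumVars`). The inclusion into `G_{t-1}` factors through `𝔪^(p+1) 𝔫^(p+1)
-- J^(t-1)`, and a Künneth argument (`koszulZ_sumVars_le_of_koszulZ_le`) reduces it to `𝔫^p J^t →
-- 𝔫^(p+1) J^(t-1)` over `S`. This last map is where the three conditions enter
-- (`koszulZ_pow_mul_pow_le`): partial derivatives with Euler's formula in characteristic zero,
-- division by variables for monomial ideals, and for Koszul powers the vanishing of `𝔫^(b+1) M →
-- 𝔫^b M` on Koszul homology.

universe v

namespace FiberPowers

/-! ### The Koszul complex, modelled on functions on finite sets -/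

section KoszulSubmodule

variable {ι : Type*} {A : Type*} [CommRing A] {M N : Type*} [AddCommGroup M] [Module A M]
  [AddCommGroup N] [Module A N]

/-- The part of degree `a` of the Koszul complex of a submodule. -/
def koszulK (ι : Type*) (a : ℕ) (U : Submodule A M) : Submodule A (Finset ι → M) where
  carrier := {f | (∀ I, f I ∈ U) ∧ ∀ I, I.card ≠ a → f I = 0}
  zero_mem' := ⟨fun _ => U.zero_mem, fun _ _ => rfl⟩
  add_mem' hf hg := ⟨fun I => U.add_mem (hf.1 I) (hg.1 I), fun I hI => by
    simp [hf.2 I hI, hg.2 I hI]⟩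
  smul_mem' c f hf := ⟨fun I => U.smul_mem c (hf.1 I), fun I hI => by simp [hf.2 I hI]⟩

theorem koszulK_mono {a : ℕ} {U V : Submodule A M} (h : U ≤ V) :
    koszulK ι a U ≤ koszulK ι a V := fun _ hf => ⟨fun I => h (hf.1 I), hf.2⟩

theorem koszulK_inf (a : ℕ) (U V : Submodule A M) :
    koszulK ι a (U ⊓ V) = koszulK ι a U ⊓ koszulK ι a V :=
  le_antisymm (le_inf (koszulK_mono inf_le_left) (koszulK_mono inf_le_right))
    fun _ hf => ⟨fun I => ⟨hf.1.1 I, hf.2.1 I⟩, hf.1.2⟩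

/-- Preimages are chosen value by value and replaced by zero outside exterior degree `a`, so the
lift stays homogeneous. -/
theorem exists_koszulK_lift (g : M →ₗ[A] N) (U : Submodule A M) {a : ℕ} {f : Finset ι → N}
    (hf : f ∈ koszulK ι a (U.map g)) :
    ∃ f' ∈ koszulK ι a U, (fun I => g (f' I)) = f := by
  classical
  choose f' hU hf' using hf.1
  refine ⟨fun I => if I.card = a then f' I else 0, ⟨fun I => ?_, fun I hI => by simp [hI]⟩, ?_⟩
  · dsimp only
    split_ifs
    exacts [hU I, U.zero_mem]
  · ext I
    by_cases hI : I.card = a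
    · simp [hI, hf']
    · simp [hI, hf.2 I hI]

theorem koszulK_sup (a : ℕ) (U V : Submodule A M) :
    koszulK ι a (U ⊔ V) = koszulK ι a U ⊔ koszulK ι a V := by
  classical
  refine le_antisymm (fun f hf => ?_)
    (sup_le (koszulK_mono le_sup_left) (koszulK_mono le_sup_right))
  choose u hu v hv huv using fun I => Submodule.mem_sup.1 (hf.1 I)
  refine Submodule.mem_sup.2 ⟨fun I => if I.card = a then u I else 0,
    ⟨fun I => ?_, fun I hI => by simp [hI]⟩, fun I => if I.card = a then v I else 0,
    ⟨fun I => ?_, fun I hI => by simp [hI]⟩, ?_⟩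
  · dsimp only
    split_ifs
    exacts [hu I, U.zero_mem]
  · dsimp only
    split_ifs
    exacts [hv I, V.zero_mem]
  · ext I
    by_cases hI : I.card = a
    · simp [hI, huv]
    · simp [hI, hf.2 I hI]

end KoszulSubmodule

/-! ### Signs, contraction, exterior multiplication and the Koszul differential -/

section Koszul

variable {ι : Type*} [DecidableEq ι]

/-- A choice of signs `i ∧ I = ± (I ∪ {i})` making the exterior products anticommute. -/
structure IsKoszulSign (sgn : ι → Finset ι → ℤ) : Prop where
  mul_self : ∀ i I, sgn i I * sgn i I = 1
  anticomm : ∀ i j I, i ≠ j → i ∉ I → j ∉ I →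
    sgn i (insert j I) * sgn j I = -(sgn j (insert i I) * sgn i I)

/-- The sign of a finite set with respect to a linear order. -/
def orderSign {ι : Type*} [LinearOrder ι] (i : ι) (I : Finset ι) : ℤ :=
  (-1) ^ (I.filter (· < i)).card

/-- The sign counts the elements below `i`. Inserting the smaller of `i`, `j` flips the sign of the
larger one, while the other insertion changes nothing. -/
theorem isKoszulSign_orderSign {ι : Type*} [LinearOrder ι] :
    IsKoszulSign (orderSign (ι := ι)) where
  mul_self i I := by
    unfold orderSign
    rw [← pow_add, ← two_mul, pow_mul]; simp
  anticomm i j I hij hi hj := by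
    unfold orderSign
    rw [Finset.filter_insert, Finset.filter_insert]
    rcases lt_or_gt_of_ne hij with h | h
    · rw [if_neg h.not_gt, if_pos h, Finset.card_insert_of_notMem (by simp [hi])]
      ring
    · rw [if_pos h, if_neg h.not_gt, Finset.card_insert_of_notMem (by simp [hj])]
      ring

variable (sgn : ι → Finset ι → ℤ) {A : Type*} [CommRing A]

section Operators

variable {M : Type*} [AddCommGroup M]

/-- Contraction with the `i`-th coordinate. -/
def contract (i : ι) : (Finset ι → M) →+ (Finset ι → M) where
  toFun f I := if i ∈ I then 0 else sgn i I • f (insert i I)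
  map_zero' := by ext; simp
  map_add' f g := by ext I; by_cases h : i ∈ I <;> simp [h]

/-- Exterior multiplication by the `i`-th basis vector. -/
def wedge (i : ι) : (Finset ι → M) →+ (Finset ι → M) where
  toFun f I := if i ∈ I then sgn i (I.erase i) • f (I.erase i) else 0
  map_zero' := by ext; simp
  map_add' f g := by ext I; by_cases h : i ∈ I <;> simp [h]

theorem contract_apply (i : ι) (f : Finset ι → M) (I : Finset ι) :
    contract sgn i f I = if i ∈ I then 0 else sgn i I • f (insert i I) := rfl

theorem wedge_apply (i : ι) (f : Finset ι → M) (I : Finset ι) :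
    wedge sgn i f I = if i ∈ I then sgn i (I.erase i) • f (I.erase i) else 0 := rfl

theorem contract_contract_self (i : ι) (f : Finset ι → M) :
    contract sgn i (contract sgn i f) = 0 := by
  ext I; simp [contract_apply]

variable {sgn}

theorem contract_contract (hs : IsKoszulSign sgn) (i j : ι) (hij : i ≠ j) (f : Finset ι → M) :
    contract sgn i (contract sgn j f) = - contract sgn j (contract sgn i f) := by
  ext I
  simp only [contract_apply, Pi.neg_apply]
  by_cases hi : i ∈ I
  · simp [hi]
  by_cases hj : j ∈ I
  · simp [hj]
  have := hs.anticomm j i I hij.symm hj hi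
  simp only [hi, hj, if_false, Finset.mem_insert, hij, hij.symm, or_self, smul_smul,
    Finset.insert_comm j i I]
  rw [mul_comm, this, mul_comm, neg_smul]

/-- Together with `contract_wedge_self` and `wedge_contract_self`, these are the Clifford relations
between contractions and exterior multiplications, on which every homotopy below rests. -/
theorem wedge_contract (hs : IsKoszulSign sgn) (i j : ι) (hij : i ≠ j) (f : Finset ι → M) :
    wedge sgn j (contract sgn i f) = - contract sgn i (wedge sgn j f) := by
  ext I
  simp only [contract_apply, wedge_apply, Pi.neg_apply]
  by_cases hi : i ∈ I
  · simp [hi, hij]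
  by_cases hj : j ∈ I
  · have h1 : i ∉ I.erase j := by simp [hi]
    have h2 : j ∉ I.erase j := by simp
    have := hs.anticomm i j (I.erase j) hij h1 h2
    rw [Finset.insert_erase hj] at this
    have e1 := hs.mul_self j (I.erase j)
    have e2 := hs.mul_self j (insert i (I.erase j))
    simp only [hi, hj, if_true, if_false, h1, smul_smul, Finset.mem_insert, or_true,
      Finset.erase_insert_of_ne hij]
    rw [← neg_smul]
    congr 1
    -- Signs are their own inverses, so multiplying the anticommutation relation by two of them and
    -- cancelling squares moves them across.
    linear_combination (sgn j (insert i (I.erase j))) * (sgn j (I.erase j)) * this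
      + (sgn i I) * (sgn j (insert i (I.erase j))) * (-e1)
      + sgn j (I.erase j) * sgn i (I.erase j) * (-e2)
  · simp [hj, hij.symm]

theorem contract_wedge_self (hs : IsKoszulSign sgn) (i : ι) (f : Finset ι → M) (I : Finset ι) :
    contract sgn i (wedge sgn i f) I = if i ∈ I then 0 else f I := by
  by_cases hi : i ∈ I <;> simp [contract_apply, wedge_apply, hi, smul_smul, hs.mul_self]

theorem wedge_contract_self (hs : IsKoszulSign sgn) (i : ι) (f : Finset ι → M) (I : Finset ι) :
    wedge sgn i (contract sgn i f) I = if i ∈ I then f I else 0 := by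
  by_cases hi : i ∈ I <;>
    simp [contract_apply, wedge_apply, hi, smul_smul, hs.mul_self, Finset.insert_erase]

variable (sgn)

theorem contract_comp {N : Type*} [AddCommGroup N] (g : M →+ N) (i : ι) (f : Finset ι → M) :
    contract sgn i (fun I => g (f I)) = fun I => g (contract sgn i f I) := by
  ext I; by_cases hi : i ∈ I <;> simp [contract_apply, hi]

theorem contract_smul [Module A M] (a : A) (i : ι) (f : Finset ι → M) :
    contract sgn i (a • f) = a • contract sgn i f := by
  ext I; by_cases hi : i ∈ I <;> simp [contract_apply, hi, smul_comm (sgn i I) a]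

theorem wedge_smul [Module A M] (a : A) (i : ι) (f : Finset ι → M) :
    wedge sgn i (a • f) = a • wedge sgn i f := by
  ext I; by_cases hi : i ∈ I <;> simp [wedge_apply, hi, smul_comm _ a]

end Operators

variable [Fintype ι] (x : ι → A) {M N : Type*} [AddCommGroup M] [Module A M]
  [AddCommGroup N] [Module A N]

/-- The differential of the Koszul complex of the sequence `x` with coefficients in `M`. -/
def koszulD : (Finset ι → M) →ₗ[A] (Finset ι → M) where
  toFun f := ∑ i, x i • contract sgn i f
  map_add' f g := by simp [Finset.sum_add_distrib]
  map_smul' a f := by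
    simp only [contract_smul, RingHom.id_apply, Finset.smul_sum]
    exact Finset.sum_congr rfl fun i _ => smul_comm _ _ _

theorem koszulD_def (f : Finset ι → M) :
    koszulD sgn x f = ∑ i, x i • contract sgn i f := rfl

theorem koszulD_apply (f : Finset ι → M) (I : Finset ι) :
    koszulD sgn x f I = ∑ i, if i ∈ I then 0 else x i • sgn i I • f (insert i I) := by
  simp [koszulD_def, Finset.sum_apply, contract_apply]

variable {sgn} in
-- The double sum cancels under swapping the two indices, the diagonal terms being zero.
theorem koszulD_koszulD (hs : IsKoszulSign sgn) (f : Finset ι → M) :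
    koszulD sgn x (koszulD sgn x f) = 0 := by
  have : koszulD sgn x (koszulD sgn x f) =
      ∑ p : ι × ι, (x p.1 * x p.2) • contract sgn p.1 (contract sgn p.2 f) := by
    rw [Fintype.sum_prod_type, koszulD_def]
    refine Finset.sum_congr rfl fun i _ => ?_
    rw [koszulD_def, map_sum, Finset.smul_sum]
    exact Finset.sum_congr rfl fun j _ => by rw [contract_smul, smul_smul]
  rw [this]
  refine Finset.sum_involution (fun p _ => p.swap) ?_ ?_ (by simp) (by simp)
  · rintro ⟨i, j⟩ -
    rcases eq_or_ne i j with rfl | hij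
    · simp [contract_contract_self]
    · simp [contract_contract hs i j hij, mul_comm (x i)]
  · rintro ⟨i, j⟩ - h h2
    simp only [Prod.swap_prod_mk, Prod.mk.injEq] at h2
    obtain ⟨rfl, -⟩ := h2
    simp [contract_contract_self] at h

theorem koszulD_comp (g : M →ₗ[A] N) (f : Finset ι → M) :
    koszulD sgn x (fun I => g (f I)) = fun I => g (koszulD sgn x f I) := by
  ext I
  simp only [koszulD_apply, map_sum]
  refine Finset.sum_congr rfl fun i _ => ?_
  split_ifs <;> simp

theorem koszulD_apply_mem {U : Submodule A M} {f : Finset ι → M} (hf : ∀ I, f I ∈ U)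
    (I : Finset ι) : koszulD sgn x f I ∈ U := by
  rw [koszulD_apply]
  refine Submodule.sum_mem _ fun i _ => ?_
  split_ifs
  · exact U.zero_mem
  · exact U.smul_mem _ (zsmul_mem (hf _) _)

theorem koszulD_apply_mem_smul {U : Submodule A M} {f : Finset ι → M} (hf : ∀ I, f I ∈ U)
    (I : Finset ι) : koszulD sgn x f I ∈ Ideal.span (Set.range x) • U := by
  rw [koszulD_apply]
  refine Submodule.sum_mem _ fun i _ => ?_
  split_ifs
  · exact zero_mem _
  · exact Submodule.smul_mem_smul (Ideal.subset_span ⟨i, rfl⟩) (zsmul_mem (hf _) _)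

theorem koszulD_mem {a : ℕ} {U : Submodule A M} {f : Finset ι → M} (hf : f ∈ koszulK ι (a + 1) U) :
    koszulD sgn x f ∈ koszulK ι a U := by
  refine ⟨koszulD_apply_mem sgn x hf.1, fun I hI => ?_⟩
  rw [koszulD_apply]
  refine Finset.sum_eq_zero fun i _ => ?_
  split_ifs with h
  · rfl
  · rw [hf.2, smul_zero, smul_zero]
    rw [Finset.card_insert_of_notMem h]
    omega

theorem koszulD_eq_zero {U : Submodule A M} {f : Finset ι → M} (hf : f ∈ koszulK ι 0 U) :
    koszulD sgn x f = 0 := by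
  ext I
  rw [koszulD_apply]
  refine Finset.sum_eq_zero fun i _ => ?_
  split_ifs with h
  · rfl
  · rw [hf.2, smul_zero, smul_zero]
    rw [Finset.card_insert_of_notMem h]
    omega

/-- The differential lowers degree by one, so only the degree `a + 1` part of a primitive matters.
This allows primitives to be built by operators that do not respect the grading. -/
theorem exists_koszulK_of_koszulD_eq {a : ℕ} {U : Submodule A M} {z w : Finset ι → M}
    (hz : ∀ I, I.card ≠ a → z I = 0) (hw : ∀ I, w I ∈ U) (h : koszulD sgn x w = z) :
    ∃ w' ∈ koszulK ι (a + 1) U, koszulD sgn x w' = z := by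
  refine ⟨fun I => if I.card = a + 1 then w I else 0,
    ⟨fun I => ?_, fun I hI => by simp [hI]⟩, ?_⟩
  · dsimp only
    split_ifs
    exacts [hw I, U.zero_mem]
  · ext I
    by_cases hI : I.card = a
    · rw [← h, koszulD_apply, koszulD_apply]
      refine Finset.sum_congr rfl fun i _ => ?_
      split_ifs with h1 h2
      · rfl
      · rfl
      · rw [Finset.card_insert_of_notMem h1, hI] at h2
        exact absurd rfl h2
    · rw [hz I hI, koszulD_apply]
      refine Finset.sum_eq_zero fun i _ => ?_
      split_ifs with h1 h2
      · rfl
      · rw [Finset.card_insert_of_notMem h1] at h2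
        omega
      · simp

end Koszul

/-! ### Subquotients -/

section Subquotient

variable {A : Type*} [CommRing A] {F F₁ F₂ G : Type*} [AddCommGroup F] [Module A F]
  [AddCommGroup F₁] [Module A F₁] [AddCommGroup F₂] [Module A F₂] [AddCommGroup G] [Module A G]

/-- The subquotient `Z / (B ∩ Z)` of a module. -/
abbrev Subquotient (Z B : Submodule A F) : Type _ := Z ⧸ B.submoduleOf Z

/-- The map to a subquotient induced by a linear map. -/
def toSubquotient (E : Submodule A G) (φ : G →ₗ[A] F) (Z B : Submodule A F)
    (h : ∀ e ∈ E, φ e ∈ Z) : E →ₗ[A] Subquotient Z B :=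
  (B.submoduleOf Z).mkQ.comp (φ.restrict h)

theorem toSubquotient_eq_zero {E : Submodule A G} {φ : G →ₗ[A] F} {Z B : Submodule A F}
    (h : ∀ e ∈ E, φ e ∈ Z) (e : E) : toSubquotient E φ Z B h e = 0 ↔ φ e ∈ B := by
  simp only [toSubquotient, LinearMap.comp_apply, Submodule.mkQ_apply,
    Submodule.Quotient.mk_eq_zero]
  rfl

theorem toSubquotient_surjective {E : Submodule A G} {φ : G →ₗ[A] F} {Z B : Submodule A F}
    (h : ∀ e ∈ E, φ e ∈ Z) (hs : ∀ z ∈ Z, ∃ e ∈ E, φ e - z ∈ B) :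
    Function.Surjective (toSubquotient E φ Z B h) := by
  intro y
  obtain ⟨⟨z, hz⟩, rfl⟩ := Submodule.mkQ_surjective _ y
  obtain ⟨e, he, hez⟩ := hs z hz
  refine ⟨⟨e, he⟩, ?_⟩
  simp only [toSubquotient, LinearMap.comp_apply, Submodule.mkQ_apply]
  rw [Submodule.Quotient.eq]
  exact hez

/-- Both subquotients are quotients of the common module `E` by the same kernel. This replaces the
snake lemma: each connecting isomorphism below arises from a suitable `E` with two maps out of it.
-/
theorem nonempty_subquotient_equiv (E : Submodule A G) (φ₁ : G →ₗ[A] F₁) (φ₂ : G →ₗ[A] F₂)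
    {Z₁ B₁ : Submodule A F₁} {Z₂ B₂ : Submodule A F₂}
    (h₁ : ∀ e ∈ E, φ₁ e ∈ Z₁) (s₁ : ∀ z ∈ Z₁, ∃ e ∈ E, φ₁ e - z ∈ B₁)
    (h₂ : ∀ e ∈ E, φ₂ e ∈ Z₂) (s₂ : ∀ z ∈ Z₂, ∃ e ∈ E, φ₂ e - z ∈ B₂)
    (hk : ∀ e ∈ E, φ₁ e ∈ B₁ ↔ φ₂ e ∈ B₂) :
    Nonempty (Subquotient Z₁ B₁ ≃ₗ[A] Subquotient Z₂ B₂) := by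
  have hker : LinearMap.ker (toSubquotient E φ₁ Z₁ B₁ h₁) =
      LinearMap.ker (toSubquotient E φ₂ Z₂ B₂ h₂) := by
    ext e
    simp only [LinearMap.mem_ker, toSubquotient_eq_zero]
    exact hk e e.2
  exact ⟨((toSubquotient E φ₁ Z₁ B₁ h₁).quotKerEquivOfSurjective
    (toSubquotient_surjective h₁ s₁)).symm.trans ((Submodule.quotEquivOfEq _ _ hker).trans
    ((toSubquotient E φ₂ Z₂ B₂ h₂).quotKerEquivOfSurjective (toSubquotient_surjective h₂ s₂)))⟩

theorem rank_subquotient_prod (k : Type*) [Field k] [Algebra k A] {T : Type*} [AddCommGroup T]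
    [Module A T] [Module k T] [IsScalarTower k A T]
    (Z₁ B₁ Z₂ B₂ Z B : Submodule A T)
    (h₁ : Z₁ ≤ Z) (h₂ : Z₂ ≤ Z) (hs : Z ≤ Z₁ ⊔ Z₂)
    (hk : ∀ z₁ ∈ Z₁, ∀ z₂ ∈ Z₂, z₁ + z₂ ∈ B ↔ z₁ ∈ B₁ ∧ z₂ ∈ B₂) :
    Module.rank k (Subquotient Z B) =
      Module.rank k (Subquotient Z₁ B₁) + Module.rank k (Subquotient Z₂ B₂) := by
  let f₁ : Subquotient Z₁ B₁ →ₗ[A] Subquotient Z B :=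
    Submodule.mapQ _ _ (Submodule.inclusion h₁) fun z hz => by
      have := (hk z z.2 0 Z₂.zero_mem).2 ⟨hz, B₂.zero_mem⟩
      rw [add_zero] at this
      exact this
  let f₂ : Subquotient Z₂ B₂ →ₗ[A] Subquotient Z B :=
    Submodule.mapQ _ _ (Submodule.inclusion h₂) fun z hz => by
      have := (hk 0 Z₁.zero_mem z z.2).2 ⟨B₁.zero_mem, hz⟩
      rw [zero_add] at this
      exact this
  have hb : Function.Bijective (f₁.coprod f₂) := by
    constructor
    · rw [injective_iff_map_eq_zero]
      rintro ⟨a, b⟩ h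
      obtain ⟨⟨a, ha⟩, rfl⟩ := Submodule.mkQ_surjective _ a
      obtain ⟨⟨b, hb⟩, rfl⟩ := Submodule.mkQ_surjective _ b
      have := (hk a ha b hb).1 ((Submodule.Quotient.mk_eq_zero (B.submoduleOf Z)
        (x := ⟨a + b, Z.add_mem (h₁ ha) (h₂ hb)⟩)).1 (by exact h))
      exact Prod.ext ((Submodule.Quotient.mk_eq_zero _).2 this.1)
        ((Submodule.Quotient.mk_eq_zero _).2 this.2)
    · intro y
      obtain ⟨⟨z, hz⟩, rfl⟩ := Submodule.mkQ_surjective _ y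
      obtain ⟨a, ha, b, hb, rfl⟩ := Submodule.mem_sup.1 (hs hz)
      exact ⟨(Submodule.Quotient.mk ⟨a, ha⟩, Submodule.Quotient.mk ⟨b, hb⟩), rfl⟩
  rw [← rank_prod' (R := k) (M := Subquotient Z₁ B₁) (M₁ := Subquotient Z₂ B₂)]
  exact ((LinearEquiv.ofBijective _ hb).restrictScalars k).rank_eq.symm

theorem rank_subquotient_trans (k : Type*) [Field k] [Algebra k A]
    [Module k F] [IsScalarTower k A F]
    {N₁ N₂ N₃ : Submodule A F} (h₁ : N₁ ≤ N₂) (h₂ : N₂ ≤ N₃) :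
    Module.rank k (Subquotient N₃ N₁) =
      Module.rank k (Subquotient N₃ N₂) + Module.rank k (Subquotient N₂ N₁) := by
  let f : Subquotient N₃ N₁ →ₗ[A] Subquotient N₃ N₂ :=
    Submodule.factor fun z hz => h₁ hz
  let g : Subquotient N₂ N₁ →ₗ[A] Subquotient N₃ N₁ :=
    Submodule.mapQ _ _ (Submodule.inclusion h₂) fun z hz => hz
  have hf : Function.Surjective f := Submodule.factor_surjective _
  have hg : Function.Injective g := by
    rw [injective_iff_map_eq_zero]
    intro y h
    obtain ⟨z, rfl⟩ := Submodule.mkQ_surjective _ y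
    exact (Submodule.Quotient.mk_eq_zero _).2 ((Submodule.Quotient.mk_eq_zero (N₁.submoduleOf N₃)
      (x := ⟨z, h₂ z.2⟩)).1 (by exact h))
  have hfg : LinearMap.ker f = LinearMap.range g := by
    ext y
    obtain ⟨⟨z, hz⟩, rfl⟩ := Submodule.mkQ_surjective _ y
    constructor
    · intro h
      have h : (Submodule.Quotient.mk ⟨z, hz⟩ : Subquotient N₃ N₂) = 0 := h
      rw [Submodule.Quotient.mk_eq_zero] at h
      exact ⟨Submodule.Quotient.mk ⟨z, h⟩, rfl⟩
    · rintro ⟨y, hy⟩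
      obtain ⟨w, rfl⟩ := Submodule.mkQ_surjective _ y
      rw [← hy]
      change (Submodule.Quotient.mk _ : Subquotient N₃ N₂) = 0
      rw [Submodule.Quotient.mk_eq_zero]
      exact w.2
  rw [← LinearMap.rank_range_add_rank_ker (f.restrictScalars k)]
  congr 1
  · rw [LinearMap.range_eq_top.2 (show Function.Surjective (f.restrictScalars k) from hf), rank_top]
  · have e := (LinearEquiv.ofInjective (g.restrictScalars k) hg).rank_eq
    rw [e]
    have : LinearMap.ker (f.restrictScalars k) = LinearMap.range (g.restrictScalars k) := by
      ext y
      exact SetLike.ext_iff.1 hfg y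
    rw [this]

end Subquotient

/-! ### Koszul homology -/

theorem exists_sum_of_mem_span_smul {ι A M : Type*} [Fintype ι] [CommRing A] [AddCommGroup M]
    [Module A M] (x : ι → A) {U : Submodule A M} {m : M}
    (h : m ∈ Ideal.span (Set.range x) • U) :
    ∃ u : ι → M, (∀ i, u i ∈ U) ∧ ∑ i, x i • u i = m := by
  refine Submodule.smul_induction_on h (fun r hr n hn => ?_) ?_
  · obtain ⟨c, rfl⟩ := Ideal.mem_span_range_iff_exists_fun.1 hr
    refine ⟨fun i => c i • n, fun i => U.smul_mem _ hn, ?_⟩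
    simp only [Finset.sum_smul, smul_smul, mul_comm]
  · rintro m n ⟨u, hu, rfl⟩ ⟨v, hv, rfl⟩
    exact ⟨u + v, fun i => U.add_mem (hu i) (hv i), by simp [Finset.sum_add_distrib]⟩

section KoszulHomology

variable {ι : Type*} [DecidableEq ι] [Fintype ι] (sgn : ι → Finset ι → ℤ)
  {A : Type*} [CommRing A] (x : ι → A) {M N : Type*} [AddCommGroup M] [Module A M]
  [AddCommGroup N] [Module A N]

/-- The cycles of degree `a` of the Koszul complex of a submodule. -/
def koszulZ (a : ℕ) (U : Submodule A M) : Submodule A (Finset ι → M) :=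
  koszulK ι a U ⊓ LinearMap.ker (koszulD sgn x)

/-- The boundaries of degree `a` of the Koszul complex of a submodule. -/
def koszulB (a : ℕ) (U : Submodule A M) : Submodule A (Finset ι → M) :=
  (koszulK ι (a + 1) U).map (koszulD sgn x)

variable {sgn x}

theorem koszulB_le (hs : IsKoszulSign sgn) (a : ℕ) (U : Submodule A M) :
    koszulB sgn x a U ≤ koszulZ sgn x a U := by
  rintro _ ⟨w, hw, rfl⟩
  exact ⟨koszulD_mem sgn x hw, koszulD_koszulD x hs w⟩

theorem koszulB_mono {a : ℕ} {U V : Submodule A M} (h : U ≤ V) :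
    koszulB sgn x a U ≤ koszulB sgn x a V := Submodule.map_mono (koszulK_mono h)

theorem koszulZ_mono {a : ℕ} {U V : Submodule A M} (h : U ≤ V) :
    koszulZ sgn x a U ≤ koszulZ sgn x a V := inf_le_inf_right _ (koszulK_mono h)

theorem koszulZ_zero (U : Submodule A M) : koszulZ sgn x 0 U = koszulK ι 0 U :=
  inf_eq_left.2 fun _ hf => koszulD_eq_zero sgn x hf

/-- Degree-zero homology of the Koszul complex is reduction modulo the ideal generated by the
sequence. -/
theorem koszulB_zero_iff (hs : IsKoszulSign sgn) {U : Submodule A M} {z : Finset ι → M}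
    (hz : ∀ I, I.card ≠ 0 → z I = 0) :
    z ∈ koszulB sgn x 0 U ↔ z ∅ ∈ Ideal.span (Set.range x) • U := by
  constructor
  · rintro ⟨w, hw, rfl⟩
    exact koszulD_apply_mem_smul sgn x hw.1 ∅
  · intro h
    obtain ⟨u, hu, hz0⟩ := exists_sum_of_mem_span_smul x h
    refine ⟨fun I => ∑ i, if I = {i} then sgn i ∅ • u i else 0, ⟨fun I => ?_, fun I hI => ?_⟩, ?_⟩
    · refine U.sum_mem fun i _ => ?_
      split_ifs
      exacts [zsmul_mem (hu i) _, U.zero_mem]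
    · refine Finset.sum_eq_zero fun i _ => if_neg ?_
      rintro rfl
      simp at hI
    · ext I
      rw [koszulD_apply]
      by_cases hI : I = ∅
      · subst hI
        rw [← hz0]
        refine Finset.sum_congr rfl fun i _ => ?_
        simp [smul_smul, hs.mul_self]
      · rw [hz I (by simpa using hI)]
        refine Finset.sum_eq_zero fun i _ => ?_
        split_ifs with hi
        · rfl
        · rw [Finset.sum_eq_zero, smul_zero, smul_zero]
          intro j _
          refine if_neg fun h => hI ?_
          have h1 := congrArg Finset.card h
          rw [Finset.card_insert_of_notMem hi, Finset.card_singleton] at h1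
          exact Finset.card_eq_zero.1 (by omega)

variable (sgn x) in
/-- The Koszul complex with coefficients in `M` is acyclic in positive degrees. -/
def KoszulAcyclic (M : Type*) [AddCommGroup M] [Module A M] : Prop :=
  ∀ a, koszulZ sgn x (a + 1) (⊤ : Submodule A M) ≤ koszulB sgn x (a + 1) ⊤

/-- A chain has only finitely many values, each finitely supported, so the primitive can be
assembled from finitely many coordinates. -/
theorem KoszulAcyclic.finsupp (h : KoszulAcyclic sgn x A) (X : Type*) :
    KoszulAcyclic sgn x (X →₀ A) := by
  classical
  intro a z hz
  have key : ∀ p : X, ∃ w ∈ koszulK ι (a + 2) (⊤ : Submodule A A),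
      koszulD sgn x w = fun I => z I p := by
    intro p
    refine h a (x := fun I => z I p) ⟨⟨fun _ => trivial, fun I hI => by simp [hz.1.2 I hI]⟩, ?_⟩
    have := koszulD_comp sgn x (Finsupp.lapply p : (X →₀ A) →ₗ[A] A) z
    rw [LinearMap.mem_ker.1 hz.2] at this
    exact this
  choose w hw hwz using key
  let s : Finset X := Finset.univ.biUnion fun I => (z I).support
  have hs : ∀ I p, p ∉ s → z I p = 0 := fun I p hp => by
    by_contra h0
    exact hp (Finset.mem_biUnion.2 ⟨I, Finset.mem_univ _, Finsupp.mem_support_iff.2 h0⟩)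
  refine ⟨∑ p ∈ s, fun I => Finsupp.lsingle (R := A) p (w p I), Submodule.sum_mem _ fun p _ =>
    ⟨fun _ => trivial, fun I hI => by simp [(hw p).2 I hI]⟩, ?_⟩
  rw [map_sum]
  simp only [koszulD_comp, hwz]
  ext I p
  rw [Finset.sum_apply, Finsupp.finsetSum_apply]
  simp only [Finsupp.lsingle_apply, Finsupp.single_apply]
  rw [Finset.sum_ite_eq' s p]
  split_ifs with hp
  · rfl
  · exact (hs I p hp).symm

/-- A projective module is a retract of a free one, and retractions carry primitives to primitives.
-/
theorem KoszulAcyclic.of_projective (h : KoszulAcyclic sgn x A) [Module.Projective A M] :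
    KoszulAcyclic sgn x M := by
  intro a z hz
  obtain ⟨s, hs⟩ := (Module.projective_def' (R := A) (P := M)).1 inferInstance
  have hz' : koszulD sgn x z = 0 := hz.2
  have hsz : (fun I => s (z I)) ∈ koszulZ sgn x (a + 1) (⊤ : Submodule A (M →₀ A)) :=
    ⟨⟨fun _ => trivial, fun I hI => by simp [hz.1.2 I hI]⟩, by
      change koszulD sgn x _ = 0
      rw [koszulD_comp, hz']; ext; simp⟩
  obtain ⟨w, hw, hwz⟩ := h.finsupp M a hsz
  refine ⟨fun I => Finsupp.linearCombination A id (w I), ⟨fun _ => trivial, fun I hI => by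
    simp [hw.2 I hI]⟩, ?_⟩
  rw [koszulD_comp, hwz]
  ext I
  exact LinearMap.congr_fun hs (z I)

variable (sgn x) in
/-- The elements of degree `a` which become cycles after applying `f`. -/
def koszulLift (f : M →ₗ[A] N) (a : ℕ) : Submodule A (Finset ι → M) :=
  koszulK ι a ⊤ ⊓ LinearMap.ker (f.compLeft (Finset ι) ∘ₗ koszulD sgn x)

theorem compLeft_mem_koszulZ {f : M →ₗ[A] N} {a : ℕ} {e : Finset ι → M}
    (he : e ∈ koszulLift sgn x f a) :
    f.compLeft (Finset ι) e ∈ koszulZ sgn x a (LinearMap.range f) :=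
  ⟨⟨fun _ => ⟨_, rfl⟩, fun I hI => by simp [he.1.2 I hI]⟩,
    (koszulD_comp sgn x f e).trans he.2⟩

theorem exists_koszulLift {f : M →ₗ[A] N} {a : ℕ} {z : Finset ι → N}
    (hz : z ∈ koszulZ sgn x a (LinearMap.range f)) :
    ∃ e ∈ koszulLift sgn x f a, f.compLeft (Finset ι) e = z := by
  rw [← Submodule.map_top] at hz
  obtain ⟨e, he, rfl⟩ := exists_koszulK_lift f ⊤ hz.1
  exact ⟨e, ⟨he, (koszulD_comp sgn x f e).symm.trans hz.2⟩, rfl⟩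

theorem koszulD_mem_koszulZ_ker (hs : IsKoszulSign sgn) {f : M →ₗ[A] N} {a : ℕ}
    {e : Finset ι → M} (he : e ∈ koszulLift sgn x f (a + 1)) :
    koszulD sgn x e ∈ koszulZ sgn x a (LinearMap.ker f) :=
  ⟨⟨fun I => congrFun he.2 I, (koszulD_mem sgn x he.1).2⟩, koszulD_koszulD x hs e⟩

/-- This is the connecting map of `0 → ker f → M → range f → 0`: acyclicity of `M` makes it
injective on homology in positive degrees. -/
theorem compLeft_mem_koszulB_iff (hs : IsKoszulSign sgn) (hM : KoszulAcyclic sgn x M)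
    {f : M →ₗ[A] N} {a : ℕ} {e : Finset ι → M} (he : e ∈ koszulLift sgn x f (a + 1)) :
    f.compLeft (Finset ι) e ∈ koszulB sgn x (a + 1) (LinearMap.range f) ↔
      koszulD sgn x e ∈ koszulB sgn x a (LinearMap.ker f) := by
  constructor
  · rintro ⟨w, hw, hwe⟩
    rw [← Submodule.map_top] at hw
    obtain ⟨v, hv, rfl⟩ := exists_koszulK_lift f ⊤ hw
    refine ⟨e - koszulD sgn x v, ⟨fun I => ?_, fun I hI => ?_⟩, ?_⟩
    · rw [koszulD_comp] at hwe
      rw [LinearMap.mem_ker, Pi.sub_apply, map_sub, sub_eq_zero]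
      exact (congrFun hwe I).symm
    · rw [Pi.sub_apply, he.1.2 I hI, (koszulD_mem sgn x hv).2 I hI, sub_zero]
    · rw [map_sub, koszulD_koszulD x hs, sub_zero]
  · rintro ⟨n, hn, hne⟩
    obtain ⟨v, hv, hve⟩ := hM a (x := e - n) ⟨sub_mem he.1 (koszulK_mono le_top hn), by
      change koszulD sgn x _ = 0
      rw [map_sub, hne, sub_self]⟩
    refine ⟨fun I => f (v I), ⟨fun I => ⟨_, rfl⟩, fun I hI => by simp [hv.2 I hI]⟩, ?_⟩
    rw [koszulD_comp, hve]
    ext I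
    simp [LinearMap.mem_ker.1 (hn.1 I)]

theorem nonempty_koszulH_equiv_succ (hs : IsKoszulSign sgn) (hM : KoszulAcyclic sgn x M)
    (f : M →ₗ[A] N) (a : ℕ) :
    Nonempty (Subquotient (koszulZ sgn x (a + 2) (LinearMap.range f))
        (koszulB sgn x (a + 2) (LinearMap.range f)) ≃ₗ[A]
      Subquotient (koszulZ sgn x (a + 1) (LinearMap.ker f))
        (koszulB sgn x (a + 1) (LinearMap.ker f))) := by
  refine nonempty_subquotient_equiv (koszulLift sgn x f (a + 2)) (f.compLeft (Finset ι))
    (koszulD sgn x) (fun e he => compLeft_mem_koszulZ he) (fun z hz => ?_)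
    (fun e he => koszulD_mem_koszulZ_ker hs he) (fun z hz => ?_)
    (fun e he => compLeft_mem_koszulB_iff hs hM he)
  · obtain ⟨e, he, rfl⟩ := exists_koszulLift hz
    exact ⟨e, he, by simp⟩
  · obtain ⟨e, he, rfl⟩ := hM a (koszulZ_mono le_top hz)
    exact ⟨e, ⟨he, by ext I; exact hz.1.1 I⟩, by simp⟩

/-- In the lowest degree the connecting map is not onto `H_0(ker f)`; its image is the kernel of
`H_0(ker f) → H_0(M)`, which is the subquotient on the right. -/
theorem nonempty_koszulH_equiv_one (hs : IsKoszulSign sgn) (hM : KoszulAcyclic sgn x M)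
    (f : M →ₗ[A] N) :
    Nonempty (Subquotient (koszulZ sgn x 1 (LinearMap.range f))
        (koszulB sgn x 1 (LinearMap.range f)) ≃ₗ[A]
      Subquotient (LinearMap.ker f ⊓ Ideal.span (Set.range x) • ⊤)
        (Ideal.span (Set.range x) • LinearMap.ker f)) := by
  refine nonempty_subquotient_equiv (koszulLift sgn x f 1) (f.compLeft (Finset ι))
    (LinearMap.proj ∅ ∘ₗ koszulD sgn x) (fun e he => compLeft_mem_koszulZ he) (fun z hz => ?_)
    (fun e he => ⟨(koszulD_mem_koszulZ_ker hs he).1.1 ∅, koszulD_apply_mem_smul sgn x he.1.1 ∅⟩)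
    (fun n hn => ?_) (fun e he => ?_)
  · obtain ⟨e, he, rfl⟩ := exists_koszulLift hz
    exact ⟨e, he, by simp⟩
  · obtain ⟨e, he, hen⟩ := (koszulB_zero_iff hs (sgn := sgn) (x := x) (U := ⊤)
      (z := fun I => if I.card = 0 then n else 0) (fun I hI => if_neg hI)).2 (by simpa using hn.2)
    refine ⟨e, ⟨he, ?_⟩, by simp [hen]⟩
    change f.compLeft (Finset ι) (koszulD sgn x e) = 0
    rw [hen]
    ext I
    have : f n = 0 := hn.1
    by_cases hI : I = ∅ <;> simp [hI, this]
  · rw [compLeft_mem_koszulB_iff hs hM he, koszulB_zero_iff hs (koszulD_mem sgn x he.1).2]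
    rfl

theorem nonempty_koszulH_equiv_zero (hs : IsKoszulSign sgn) (U : Submodule A M) :
    Nonempty (Subquotient (koszulZ sgn x 0 U) (koszulB sgn x 0 U) ≃ₗ[A]
      Subquotient U (Ideal.span (Set.range x) • U)) := by
  refine nonempty_subquotient_equiv (koszulZ sgn x 0 U) LinearMap.id (LinearMap.proj ∅)
    (fun _ h => h) (fun z hz => ⟨z, hz, by simp⟩) (fun e he => he.1.1 ∅)
    (fun n hn => ⟨fun I => if I.card = 0 then n else 0, ?_, by simp⟩)
    (fun e he => koszulB_zero_iff hs he.1.2)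
  rw [koszulZ_zero]
  refine ⟨fun I => ?_, fun I hI => if_neg hI⟩
  dsimp only
  split_ifs
  exacts [hn, U.zero_mem]

end KoszulHomology

/-! ### Koszul homology computes Tor -/

section TorComparison

theorem one_tmul_eq_zero_iff {A P : Type*} [CommRing A] [AddCommGroup P] [Module A P]
    (𝔐 : Ideal A) (p : P) : ((1 : A ⧸ 𝔐) ⊗ₜ[A] p) = 0 ↔ p ∈ 𝔐 • (⊤ : Submodule A P) := by
  rw [← (TensorProduct.quotTensorEquivQuotSMul P 𝔐).map_eq_zero_iff, ← map_one (Ideal.Quotient.mk 𝔐),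
    TensorProduct.quotTensorEquivQuotSMul_mk_tmul, one_smul, Submodule.Quotient.mk_eq_zero]

theorem exists_one_tmul {A P : Type*} [CommRing A] [AddCommGroup P] [Module A P]
    (𝔐 : Ideal A) (y : (A ⧸ 𝔐) ⊗[A] P) : ∃ p : P, (1 : A ⧸ 𝔐) ⊗ₜ[A] p = y := by
  induction y with
  | zero => exact ⟨0, by simp⟩
  | tmul a p =>
    obtain ⟨a, rfl⟩ := Ideal.Quotient.mk_surjective a
    refine ⟨a • p, ?_⟩
    rw [← TensorProduct.smul_tmul, Algebra.smul_def, mul_one]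
    rfl
  | add y z hy hz =>
    obtain ⟨p, rfl⟩ := hy
    obtain ⟨q, rfl⟩ := hz
    exact ⟨p + q, TensorProduct.tmul_add _ _ _⟩

/-- Every element of `A ⧸ 𝔐 ⊗ P₁` is `1 ⊗ p`; sending it to `g p` expresses the homology through the
image of `g` alone. The result has the same shape as `nonempty_koszulH_equiv_one`, which is what
allows Tor to be compared with Koszul homology without a double complex. -/
theorem nonempty_homology_lTensor_equiv {A P₂ P₁ P₀ : Type*} [CommRing A] [AddCommGroup P₂]
    [Module A P₂] [AddCommGroup P₁] [Module A P₁] [AddCommGroup P₀] [Module A P₀] (𝔐 : Ideal A)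
    (f : P₂ →ₗ[A] P₁) (g : P₁ →ₗ[A] P₀) (h : LinearMap.ker g = LinearMap.range f) :
    Nonempty (Subquotient (LinearMap.ker (g.lTensor (A ⧸ 𝔐))) (LinearMap.range (f.lTensor (A ⧸ 𝔐)))
      ≃ₗ[A] Subquotient (LinearMap.range g ⊓ 𝔐 • ⊤) (𝔐 • LinearMap.range g)) := by
  have hg : ∀ p, g p ∈ 𝔐 • LinearMap.range g ↔ p ∈ 𝔐 • (⊤ : Submodule A P₁) ⊔ LinearMap.range f := by
    intro p
    rw [← h, ← Submodule.comap_map_eq, Submodule.map_smul'', Submodule.map_top]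
    rfl
  have hf : ∀ p, (1 : A ⧸ 𝔐) ⊗ₜ[A] p ∈ LinearMap.range (f.lTensor (A ⧸ 𝔐)) ↔
      p ∈ 𝔐 • (⊤ : Submodule A P₁) ⊔ LinearMap.range f := by
    intro p
    constructor
    · rintro ⟨y, hy⟩
      obtain ⟨q, rfl⟩ := exists_one_tmul 𝔐 y
      rw [LinearMap.lTensor_tmul, eq_comm, ← sub_eq_zero, ← TensorProduct.tmul_sub,
        one_tmul_eq_zero_iff] at hy
      exact Submodule.mem_sup.2 ⟨_, hy, _, ⟨q, rfl⟩, by simp⟩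
    · intro hp
      obtain ⟨a, ha, _, ⟨q, rfl⟩, rfl⟩ := Submodule.mem_sup.1 hp
      refine ⟨1 ⊗ₜ q, ?_⟩
      rw [TensorProduct.tmul_add, (one_tmul_eq_zero_iff 𝔐 a).2 ha, zero_add, LinearMap.lTensor_tmul]
  refine nonempty_subquotient_equiv ((𝔐 • ⊤ : Submodule A P₀).comap g)
    (TensorProduct.mk A (A ⧸ 𝔐) P₁ 1) g (fun e he => ?_) (fun z hz => ?_)
    (fun e he => ⟨⟨e, rfl⟩, he⟩) ?_ (fun e _ => ?_)
  · rw [LinearMap.mem_ker, TensorProduct.mk_apply, LinearMap.lTensor_tmul, one_tmul_eq_zero_iff]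
    exact he
  · obtain ⟨p, rfl⟩ := exists_one_tmul 𝔐 z
    rw [LinearMap.mem_ker, LinearMap.lTensor_tmul, one_tmul_eq_zero_iff] at hz
    exact ⟨p, hz, by simp⟩
  · rintro _ ⟨⟨p, rfl⟩, hp⟩
    exact ⟨p, hp, by simp⟩
  · rw [hg]
    exact hf e

theorem nonempty_homology_equiv_subquotient {A : Type u} [CommRing A]
    (S : ShortComplex (ModuleCat.{u} A)) :
    Nonempty (S.homology ≃ₗ[A]
      Subquotient (LinearMap.ker S.g.hom) (LinearMap.range S.f.hom)) := by
  refine ⟨S.moduleCatHomologyIso.toLinearEquiv.trans (Submodule.quotEquivOfEq _ _ ?_)⟩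
  ext z
  constructor
  · rintro ⟨y, rfl⟩
    exact ⟨y, rfl⟩
  · rintro ⟨y, hy⟩
    exact ⟨y, Subtype.ext hy⟩

variable {A : Type u} [CommRing A]

theorem ker_eq_range_of_exact {S : ShortComplex (ModuleCat.{u} A)} (h : S.Exact) :
    LinearMap.ker S.g.hom = LinearMap.range S.f.hom := h.moduleCat_range_eq_ker.symm

theorem nonempty_tor_succ_equiv (𝔐 : Ideal A) {X : ModuleCat.{u} A} (P : ProjectiveResolution X)
    (i : ℕ) :
    Nonempty ((((Tor (ModuleCat.{u} A) (i + 1)).obj (ModuleCat.of A (A ⧸ 𝔐))).obj X) ≃ₗ[A]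
      Subquotient (LinearMap.range (P.complex.d (i + 1) i).hom ⊓ 𝔐 • ⊤)
        (𝔐 • LinearMap.range (P.complex.d (i + 1) i).hom)) := by
  let F := (MonoidalCategory.tensoringLeft (ModuleCat.{u} A)).obj (ModuleCat.of A (A ⧸ 𝔐))
  let K := (F.mapHomologicalComplex (ComplexShape.down ℕ)).obj P.complex
  have e₁ : ((((Tor (ModuleCat.{u} A) (i + 1)).obj (ModuleCat.of A (A ⧸ 𝔐))).obj X) ≅
      K.homology (i + 1)) := P.isoLeftDerivedObj F (i + 1)
  have e₂ : K.homology (i + 1) ≅ (K.sc' (i + 2) (i + 1) i).homology :=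
    ShortComplex.homologyMapIso (K.isoSc' (i + 2) (i + 1) i (by simp) (by simp))
  obtain ⟨e₃⟩ := nonempty_homology_equiv_subquotient (K.sc' (i + 2) (i + 1) i)
  obtain ⟨e₄⟩ := nonempty_homology_lTensor_equiv 𝔐 (P.complex.d (i + 2) (i + 1)).hom
    (P.complex.d (i + 1) i).hom (ker_eq_range_of_exact (P.exact_succ i))
  exact ⟨e₁.toLinearEquiv.trans (e₂.toLinearEquiv.trans (e₃.trans e₄))⟩

theorem nonempty_tor_zero_equiv (𝔐 : Ideal A) (M : Type u) [AddCommGroup M] [Module A M] :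
    Nonempty ((((Tor (ModuleCat.{u} A) 0).obj (ModuleCat.of A (A ⧸ 𝔐))).obj (ModuleCat.of A M))
      ≃ₗ[A] M ⧸ 𝔐 • (⊤ : Submodule A M)) := by
  let F := (MonoidalCategory.tensoringLeft (ModuleCat.{u} A)).obj (ModuleCat.of A (A ⧸ 𝔐))
  have e₁ : ((((Tor (ModuleCat.{u} A) 0).obj (ModuleCat.of A (A ⧸ 𝔐))).obj (ModuleCat.of A M)) ≅
      F.obj (ModuleCat.of A M)) := F.leftDerivedZeroIsoSelf.app _
  exact ⟨e₁.toLinearEquiv.trans (TensorProduct.quotTensorEquivQuotSMul M 𝔐)⟩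

variable {ι : Type*} [DecidableEq ι] [Fintype ι] {sgn : ι → Finset ι → ℤ} {x : ι → A}

/-- Dimension shifting: each syzygy lowers the Koszul degree by one, until degree one is reached and
`nonempty_koszulH_equiv_one` applies. -/
theorem nonempty_koszulH_equiv_resolution (hs : IsKoszulSign sgn) (hA : KoszulAcyclic sgn x A)
    {X : ModuleCat.{u} A} (P : ProjectiveResolution X) {N : Type u} [AddCommGroup N] [Module A N]
    (f : P.complex.X 0 →ₗ[A] N)
    (hf : LinearMap.ker f = LinearMap.range (P.complex.d 1 0).hom) (i : ℕ) :
    Nonempty (Subquotient (koszulZ sgn x (i + 1) (LinearMap.range f))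
        (koszulB sgn x (i + 1) (LinearMap.range f)) ≃ₗ[A]
      Subquotient (LinearMap.range (P.complex.d (i + 1) i).hom ⊓ Ideal.span (Set.range x) • ⊤)
        (Ideal.span (Set.range x) • LinearMap.range (P.complex.d (i + 1) i).hom)) := by
  have hP : ∀ j, KoszulAcyclic sgn x (P.complex.X j) := fun j => by
    have : Module.Projective A (P.complex.X j) :=
      (IsProjective.iff_projective _).2 (P.projective j)
    exact hA.of_projective
  have hex : ∀ j, LinearMap.ker (P.complex.d (j + 1) j).hom =
      LinearMap.range (P.complex.d (j + 2) (j + 1)).hom :=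
    fun j => ker_eq_range_of_exact (P.exact_succ j)
  have step : ∀ n j m, m = n + j + 1 → Nonempty (Subquotient
        (koszulZ sgn x (n + 1) (LinearMap.range (P.complex.d (j + 1) j).hom))
        (koszulB sgn x (n + 1) (LinearMap.range (P.complex.d (j + 1) j).hom)) ≃ₗ[A]
      Subquotient (LinearMap.range (P.complex.d (m + 1) m).hom ⊓ Ideal.span (Set.range x) • ⊤)
        (Ideal.span (Set.range x) • LinearMap.range (P.complex.d (m + 1) m).hom)) := by
    intro n
    induction n with
    | zero =>
      rintro j m hm
      obtain rfl : m = j + 1 := by omega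
      obtain ⟨e⟩ := nonempty_koszulH_equiv_one hs (hP (j + 1)) (P.complex.d (j + 1) j).hom
      rw [hex j] at e
      exact ⟨e⟩
    | succ n ih =>
      intro j m hm
      obtain ⟨e₁⟩ := nonempty_koszulH_equiv_succ hs (hP (j + 1)) (P.complex.d (j + 1) j).hom n
      obtain ⟨e₂⟩ := ih (j + 1) m (by omega)
      rw [hex j] at e₁
      exact ⟨e₁.trans e₂⟩
  cases i with
  | zero =>
    obtain ⟨e⟩ := nonempty_koszulH_equiv_one hs (hP 0) f
    rw [hf] at e
    exact ⟨e⟩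
  | succ i =>
    obtain ⟨e₁⟩ := nonempty_koszulH_equiv_succ hs (hP 0) f i
    obtain ⟨e₂⟩ := step i 0 (i + 1) rfl
    rw [hf] at e₁
    exact ⟨e₁.trans e₂⟩

theorem nonempty_tor_equiv_koszulH (hs : IsKoszulSign sgn) (hA : KoszulAcyclic sgn x A)
    (U : Ideal A) (i : ℕ) :
    Nonempty ((((Tor (ModuleCat.{u} A) i).obj (ModuleCat.of A
        (A ⧸ Ideal.span (Set.range x)))).obj (ModuleCat.of A U)) ≃ₗ[A]
      Subquotient (koszulZ sgn x i U) (koszulB sgn x i U)) := by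
  cases i with
  | zero =>
    obtain ⟨e₁⟩ := nonempty_tor_zero_equiv (Ideal.span (Set.range x)) U
    obtain ⟨e₂⟩ := nonempty_koszulH_equiv_zero (x := x) hs U
    refine ⟨e₁.trans ((Submodule.quotEquivOfEq _ _ ?_).trans e₂.symm)⟩
    ext z
    rw [Submodule.mem_smul_top_iff]
    rfl
  | succ i =>
    let P := ProjectiveResolution.of (ModuleCat.of A U)
    obtain ⟨e₁⟩ := nonempty_tor_succ_equiv (Ideal.span (Set.range x)) P i
    let p : P.complex.X 0 →ₗ[A] U := (P.π.f 0).hom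
    have hp : Function.Surjective p := by
      have : Epi (P.π.f 0) := inferInstance
      exact (ModuleCat.epi_iff_surjective _).1 this
    have hker : LinearMap.ker (U.subtype ∘ₗ p) = LinearMap.range (P.complex.d 1 0).hom := by
      rw [LinearMap.ker_comp_of_ker_eq_bot _ U.ker_subtype]
      exact ker_eq_range_of_exact P.exact₀
    obtain ⟨e₂⟩ := nonempty_koszulH_equiv_resolution hs hA P (U.subtype ∘ₗ p) hker i
    have hr : LinearMap.range (U.subtype ∘ₗ p) = U := by
      rw [LinearMap.range_comp_of_range_eq_top _ (LinearMap.range_eq_top.2 hp), U.range_subtype]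
    rw [hr] at e₂
    exact ⟨e₁.trans e₂.symm⟩

/-- Koszul chains are functions on `Finset ι` and so live in a larger universe than `A`; hence the
lift. -/
theorem lift_bettiNumber_eq_rank_koszulH (k : Type*) [Field k] [Algebra k A]
    {ι : Type v} [DecidableEq ι] [Fintype ι] {sgn : ι → Finset ι → ℤ} {x : ι → A}
    (hs : IsKoszulSign sgn) (hA : KoszulAcyclic sgn x A) (U : Ideal A) (i : ℕ) :
    Cardinal.lift.{v} (bettiNumber k (Ideal.span (Set.range x)) i U) =
      Module.rank k (Subquotient (koszulZ sgn x i U) (koszulB sgn x i U)) := by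
  obtain ⟨e⟩ := nonempty_tor_equiv_koszulH hs hA U i
  let e' : RestrictScalars k A (((Tor (ModuleCat.{u} A) i).obj (ModuleCat.of A
      (A ⧸ Ideal.span (Set.range x)))).obj (ModuleCat.of A U)) ≃ₗ[k]
      Subquotient (koszulZ sgn x i U) (koszulB sgn x i U) :=
    { (RestrictScalars.addEquiv k A _).trans e.toAddEquiv with
      map_smul' := fun c y => by
        change e (RestrictScalars.addEquiv k A _ (c • y)) = c • e (RestrictScalars.addEquiv k A _ y)
        rw [RestrictScalars.addEquiv_map_smul, map_smul, algebraMap_smul] }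
  exact (congrFun Cardinal.lift_umax.{u, v} _).symm.trans (e'.lift_rank_eq.trans (Cardinal.lift_id'.{u, v} _))

/-- If `A ∩ B → A` and `A ∩ B → B` are zero on Koszul homology, then the Betti numbers split. -/
theorem bettiNumbersSplit_of_koszul (k : Type*) [Field k] [Algebra k A]
    {ι : Type v} [DecidableEq ι] [Fintype ι] {sgn : ι → Finset ι → ℤ} {x : ι → A}
    (hs : IsKoszulSign sgn) (hA : KoszulAcyclic sgn x A) (U V : Ideal A)
    (hU : ∀ i, koszulZ sgn x i (U ⊓ V) ≤ koszulB sgn x i U)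
    (hV : ∀ i, koszulZ sgn x i (U ⊓ V) ≤ koszulB sgn x i V) :
    BettiNumbersSplit k (Ideal.span (Set.range x)) (U + V) U V := by
  have hBsup : ∀ i, koszulB sgn x i (U ⊔ V) = koszulB sgn x i U ⊔ koszulB sgn x i V := fun i => by
    rw [koszulB, koszulK_sup, Submodule.map_sup]
    rfl
  -- Vanishing of the two maps from the homology of `U ⊓ V` makes the homologies of `U` and `V`
  -- independent inside that of `U ⊔ V`.
  have hprod : ∀ i, Module.rank k (Subquotient (koszulZ sgn x i U ⊔ koszulZ sgn x i V)
      (koszulB sgn x i (U ⊔ V))) =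
        Module.rank k (Subquotient (koszulZ sgn x i U) (koszulB sgn x i U)) +
        Module.rank k (Subquotient (koszulZ sgn x i V) (koszulB sgn x i V)) := by
    intro i
    refine rank_subquotient_prod k _ _ _ _ _ _ le_sup_left le_sup_right le_rfl
      fun z₁ h₁ z₂ h₂ => ⟨fun h => ?_, fun h => ?_⟩
    · rw [hBsup] at h
      obtain ⟨u, hu, v, hv, huv⟩ := Submodule.mem_sup.1 h
      have e : z₁ - u = v - z₂ := by
        rw [sub_eq_sub_iff_add_eq_add, huv.symm, add_comm v]
      have hn : z₁ - u ∈ koszulZ sgn x i (U ⊓ V) := by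
        refine ⟨?_, (sub_mem h₁ (koszulB_le hs i U hu)).2⟩
        rw [koszulK_inf]
        refine ⟨(sub_mem h₁ (koszulB_le hs i U hu)).1, ?_⟩
        rw [e]
        exact (sub_mem (koszulB_le hs i V hv) h₂).1
      refine ⟨(Submodule.sub_mem_iff_left _ hu).1 (hU i hn), ?_⟩
      rw [e] at hn
      exact (Submodule.sub_mem_iff_right _ hv).1 (hV i hn)
    · rw [hBsup]
      exact add_mem (Submodule.mem_sup_left h.1) (Submodule.mem_sup_right h.2)
  have hZsup : ∀ i, koszulZ sgn x i U ⊔ koszulZ sgn x i V ≤ koszulZ sgn x i (U ⊔ V) := fun i =>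
    sup_le (koszulZ_mono le_sup_left) (koszulZ_mono le_sup_right)
  rw [BettiNumbersSplit, Submodule.add_eq_sup]
  constructor
  · rw [← Cardinal.lift_inj.{u, v}, Cardinal.lift_add]
    simp only [lift_bettiNumber_eq_rank_koszulH k hs hA]
    -- In degree zero every chain is a cycle, so the cycles of `U ⊔ V` are already sums and no
    -- correction term appears.
    rw [← hprod, koszulZ_zero, koszulZ_zero, koszulZ_zero, koszulK_sup]
  · intro i
    rw [← Cardinal.lift_inj.{u, v}, Cardinal.lift_add, Cardinal.lift_add]
    simp only [lift_bettiNumber_eq_rank_koszulH k hs hA]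
    rw [← hprod, rank_subquotient_trans k (N₂ := koszulZ sgn x (i + 1) U ⊔ koszulZ sgn x (i + 1) V)
      (by rw [hBsup]; exact sup_le_sup (koszulB_le hs _ _) (koszulB_le hs _ _)) (hZsup _), add_comm]
    congr 1
    -- The Mayer–Vietoris connecting map: a pair `(u, v)` with `d (u + v) = 0` gives the cycle `u +
    -- v` on one side and `d u = -d v`, with values in `U ⊓ V`, on the other.
    let E : Submodule A ((Finset ι → A) × (Finset ι → A)) :=
      ((koszulK ι (i + 1) U).prod (koszulK ι (i + 1) V)) ⊓
        LinearMap.ker (koszulD sgn x ∘ₗ (LinearMap.fst A _ _ + LinearMap.snd A _ _))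
    have hE : ∀ e ∈ E, koszulD sgn x e.1 = - koszulD sgn x e.2 := fun e he => by
      have : koszulD sgn x (e.1 + e.2) = 0 := he.2
      rwa [map_add, add_eq_zero_iff_eq_neg] at this
    suffices h : Nonempty (Subquotient (koszulZ sgn x (i + 1) (U ⊔ V))
        (koszulZ sgn x (i + 1) U ⊔ koszulZ sgn x (i + 1) V) ≃ₗ[A]
        Subquotient (koszulZ sgn x i (U ⊓ V)) (koszulB sgn x i (U ⊓ V))) from
      h.elim fun e => (e.restrictScalars k).rank_eq
    refine nonempty_subquotient_equiv E (LinearMap.fst A _ _ + LinearMap.snd A _ _)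
      (koszulD sgn x ∘ₗ LinearMap.fst A _ _)
      (fun e he => ⟨add_mem (koszulK_mono le_sup_left he.1.1) (koszulK_mono le_sup_right he.1.2),
        he.2⟩) ?_ (fun e he => ?_) ?_ ?_
    · intro z hz
      have h := hz.1
      rw [koszulK_sup] at h
      obtain ⟨u, hu, v, hv, rfl⟩ := Submodule.mem_sup.1 h
      exact ⟨(u, v), ⟨⟨hu, hv⟩, hz.2⟩, by simp⟩
    · refine ⟨?_, koszulD_koszulD x hs _⟩
      rw [koszulK_inf]
      refine ⟨koszulD_mem sgn x he.1.1, ?_⟩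
      change koszulD sgn x e.1 ∈ _
      rw [hE e he]
      exact neg_mem (koszulD_mem sgn x he.1.2)
    -- Surjectivity of the connecting map is the place where a cycle of `U ⊓ V` must bound in both
    -- `U` and `V`.
    · intro z hz
      obtain ⟨u, hu, rfl⟩ := hU i hz
      obtain ⟨v, hv, hvu⟩ := hV i hz
      refine ⟨(u, -v), ⟨⟨hu, neg_mem hv⟩, ?_⟩, by simp⟩
      change koszulD sgn x (u + -v) = 0
      rw [map_add, map_neg, hvu, add_neg_cancel]
    · intro e he
      constructor
      · intro h
        obtain ⟨u, hu, v, hv, huv⟩ := Submodule.mem_sup.1 h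
        have huv : u + v = e.1 + e.2 := huv
        have h1 : e.1 - u = v - e.2 := by
          rw [sub_eq_sub_iff_add_eq_add, huv.symm, add_comm v]
        refine ⟨e.1 - u, ?_, ?_⟩
        · rw [SetLike.mem_coe, koszulK_inf]
          refine ⟨sub_mem he.1.1 hu.1, ?_⟩
          rw [h1]
          exact sub_mem hv.1 he.1.2
        · have : koszulD sgn x u = 0 := hu.2
          rw [map_sub, this, sub_zero]
          rfl
      · rintro ⟨n, hn, hne⟩
        have hne : koszulD sgn x n = koszulD sgn x e.1 := hne
        have : e.1 + e.2 = (e.1 - n) + (n + e.2) := by abel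
        change e.1 + e.2 ∈ _
        rw [SetLike.mem_coe, koszulK_inf] at hn
        rw [this]
        refine add_mem (Submodule.mem_sup_left ⟨sub_mem he.1.1 hn.1, ?_⟩)
          (Submodule.mem_sup_right ⟨add_mem hn.2 he.1.2, ?_⟩)
        · change koszulD sgn x (e.1 - n) = 0
          rw [map_sub, hne, sub_self]
        · change koszulD sgn x (n + e.2) = 0
          rw [map_add, hne, hE e he, neg_add_cancel]

end TorComparison

/-! ### Contracting homotopies -/

section Homotopy

variable {ι : Type*} [DecidableEq ι] {sgn : ι → Finset ι → ℤ}
  {A : Type*} [CommRing A] {x : ι → A} {M : Type*} [AddCommGroup M] [Module A M]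

theorem wedge_mem_koszulK {a : ℕ} {V : Submodule A M} {f : Finset ι → M} (j : ι)
    (hf : f ∈ koszulK ι a V) : wedge sgn j f ∈ koszulK ι (a + 1) V := by
  refine ⟨fun I => ?_, fun I hI => ?_⟩
  · rw [wedge_apply]
    split_ifs
    exacts [zsmul_mem (hf.1 _) _, V.zero_mem]
  · rw [wedge_apply]
    split_ifs with h
    · rw [hf.2, smul_zero]
      have := Finset.card_erase_add_one h
      omega
    · rfl

variable [Fintype ι]

/-- Applying `δ` to `d z = 0` expresses `contract j z` through the other contractions of `δ z`;
after wedging with `j`, the Clifford relations collapse the sum. Hence subtracting this boundary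
from `z` removes everything involving the `j`-th basis vector and everything divisible by `x j`. -/
theorem koszulD_wedge (hs : IsKoszulSign sgn) (j : ι) (δ : M →+ M)
    (h₁ : ∀ m, δ (x j • m) = m) (h₂ : ∀ i m, i ≠ j → δ (x i • m) = x i • δ m)
    {z : Finset ι → M} (hz : koszulD sgn x z = 0) (I : Finset ι) :
    koszulD sgn x (wedge sgn j fun I => δ (z I)) I = if j ∈ I then z I else x j • δ (z I) := by
  set y : Finset ι → M := fun I => δ (z I) with hy
  have e₁ : koszulD sgn x (wedge sgn j y) = x j • contract sgn j (wedge sgn j y) +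
      ∑ i ∈ Finset.univ.erase j, x i • contract sgn i (wedge sgn j y) := by
    rw [koszulD_def]
    exact (Finset.add_sum_erase _ (fun i => x i • contract sgn i (wedge sgn j y))
      (Finset.mem_univ j)).symm
  have e₂ : (0 : Finset ι → M) = wedge sgn j (contract sgn j z) +
      ∑ i ∈ Finset.univ.erase j, x i • wedge sgn j (contract sgn i y) := by
    have h0 : (fun I => δ (koszulD sgn x z I)) = 0 := by rw [hz]; ext; simp
    have : (fun I => δ (koszulD sgn x z I)) = contract sgn j z +
        ∑ i ∈ Finset.univ.erase j, x i • contract sgn i y := by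
      ext I
      rw [koszulD_def, ← Finset.add_sum_erase _ _ (Finset.mem_univ j)]
      simp only [Pi.add_apply, Finset.sum_apply, map_add, map_sum, Pi.smul_apply, h₁]
      refine congrArg _ (Finset.sum_congr rfl fun i hi => ?_)
      rw [h₂ i _ (Finset.ne_of_mem_erase hi), hy, contract_comp]
    rw [h0] at this
    have := congrArg (wedge sgn j) this
    simpa only [map_zero, map_add, map_sum, wedge_smul] using this
  have e₃ : ∑ i ∈ Finset.univ.erase j, x i • wedge sgn j (contract sgn i y) =
      - ∑ i ∈ Finset.univ.erase j, x i • contract sgn i (wedge sgn j y) := by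
    rw [← Finset.sum_neg_distrib]
    refine Finset.sum_congr rfl fun i hi => ?_
    rw [wedge_contract hs i j (Finset.ne_of_mem_erase hi), smul_neg]
  rw [e₃, ← sub_eq_add_neg, eq_comm, sub_eq_zero] at e₂
  rw [e₁, ← e₂, Pi.add_apply, Pi.smul_apply, contract_wedge_self hs, wedge_contract_self hs]
  split_ifs <;> simp [hy]

/-- Subtracting boundaries, a cycle can be made independent of a given set of variables, where
`δ j` divides by the variable `x j` and discards what is not divisible. -/
theorem exists_koszul_reduction (hs : IsKoszulSign sgn) (δ : ι → M →+ M) (s : Finset ι)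
    (h₁ : ∀ j m, δ j (x j • m) = m) (h₂ : ∀ i j m, i ≠ j → δ j (x i • m) = x i • δ j m)
    (h₃ : ∀ i j m, δ i (δ j m) = δ j (δ i m))
    {P V : Submodule A M} (hP : ∀ j ∈ s, ∀ m ∈ P, x j • δ j m ∈ P)
    (hV : ∀ j ∈ s, ∀ m ∈ P, δ j m ∈ V) {a : ℕ} {z : Finset ι → M}
    (hz : z ∈ koszulZ sgn x a P) :
    ∃ w ∈ koszulK ι (a + 1) V, z - koszulD sgn x w ∈ koszulZ sgn x a P ∧
      ∀ j ∈ s, ∀ I, δ j ((z - koszulD sgn x w) I) = 0 ∧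
        (j ∈ I → (z - koszulD sgn x w) I = 0) := by
  induction s using Finset.induction_on with
  | empty => exact ⟨0, zero_mem _, by simpa using hz, by simp⟩
  | insert j s hj ih =>
    obtain ⟨w, hw, hwz, hws⟩ := ih (fun j hj => hP j (Finset.mem_insert_of_mem hj))
      (fun j hj => hV j (Finset.mem_insert_of_mem hj))
    set y := z - koszulD sgn x w with hy
    let v : Finset ι → M := wedge sgn j fun I => δ j (y I)
    have hv : v ∈ koszulK ι (a + 1) V := by
      refine wedge_mem_koszulK j ⟨fun I => hV j (Finset.mem_insert_self _ _) _ (hwz.1.1 I),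
        fun I hI => by simp [hwz.1.2 I hI]⟩
    have hdv : ∀ I, (y - koszulD sgn x v) I = if j ∈ I then 0 else y I - x j • δ j (y I) := by
      intro I
      rw [Pi.sub_apply, koszulD_wedge hs j (δ j) (h₁ j) (fun i m hi => h₂ i j m hi) hwz.2]
      split_ifs <;> simp
    refine ⟨w + v, add_mem hw hv, ?_⟩
    rw [show z - koszulD sgn x (w + v) = y - koszulD sgn x v by rw [map_add, hy]; abel]
    refine ⟨⟨⟨fun I => ?_, fun I hI => ?_⟩, ?_⟩, fun i hi I => ?_⟩
    · rw [hdv]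
      split_ifs
      exacts [P.zero_mem, P.sub_mem (hwz.1.1 I) (hP j (Finset.mem_insert_self _ _) _ (hwz.1.1 I))]
    · rw [hdv, hwz.1.2 I hI]
      simp
    · change koszulD sgn x _ = 0
      have : koszulD sgn x y = 0 := hwz.2
      rw [map_sub, this, koszulD_koszulD x hs, sub_zero]
    · rw [hdv]
      rcases Finset.mem_insert.1 hi with rfl | his
      · constructor
        · split_ifs <;> simp [h₁]
        · intro hI
          simp [hI]
      · have hij : i ≠ j := by
          rintro rfl
          exact hj his
        constructor
        · split_ifs
          · simp
          · rw [map_sub, h₂ j i _ hij.symm, h₃, (hws i his I).1]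
            simp
        · intro hI
          simp [(hws i his I).2 hI]

/-- The reduced cycle has all its values in `P` and killed by every `δ j` with `j ∈ s`, hence is
zero. The set `s` may omit variables: eliminating those of `R` is enough for ideals contained in
`𝔪`. -/
theorem koszulZ_le_koszulB_of_division (hs : IsKoszulSign sgn) (δ : ι → M →+ M) (s : Finset ι)
    (h₁ : ∀ j m, δ j (x j • m) = m) (h₂ : ∀ i j m, i ≠ j → δ j (x i • m) = x i • δ j m)
    (h₃ : ∀ i j m, δ i (δ j m) = δ j (δ i m))
    {P V : Submodule A M} (hP : ∀ j ∈ s, ∀ m ∈ P, x j • δ j m ∈ P)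
    (hV : ∀ j ∈ s, ∀ m ∈ P, δ j m ∈ V) (h0 : ∀ m ∈ P, (∀ j ∈ s, δ j m = 0) → m = 0) (a : ℕ) :
    koszulZ sgn x a P ≤ koszulB sgn x a V := by
  intro z hz
  obtain ⟨w, hw, hwz, hws⟩ := exists_koszul_reduction hs δ s h₁ h₂ h₃ hP hV hz
  refine ⟨w, hw, ?_⟩
  ext I
  exact (sub_eq_zero.1 (h0 _ (hwz.1.1 I) fun j hj => (hws j hj I).1)).symm

/-- After eliminating all variables, a cycle can survive only at the empty set, which positive
degree excludes. -/
theorem koszulAcyclic_of_division (hs : IsKoszulSign sgn) (δ : ι → M →+ M)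
    (h₁ : ∀ j m, δ j (x j • m) = m) (h₂ : ∀ i j m, i ≠ j → δ j (x i • m) = x i • δ j m)
    (h₃ : ∀ i j m, δ i (δ j m) = δ j (δ i m)) : KoszulAcyclic sgn x M := by
  intro a z hz
  obtain ⟨w, hw, hwz, hws⟩ := exists_koszul_reduction hs δ Finset.univ h₁ h₂ h₃
    (P := ⊤) (V := ⊤) (fun _ _ _ _ => trivial) (fun _ _ _ _ => trivial) hz
  refine ⟨w, hw, ?_⟩
  ext I
  refine (sub_eq_zero.1 ?_).symm
  rcases I.eq_empty_or_nonempty with rfl | ⟨j, hj⟩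
  · exact hwz.1.2 ∅ (by simp)
  · exact (hws j (Finset.mem_univ j) I).2 hj

/-- Cartan's formula for the homotopy given by derivations `δ j` dual to the sequence `x`. -/
theorem koszulD_sum_wedge (hs : IsKoszulSign sgn) (δ : ι → M →+ M)
    (h : ∀ i j m, δ j (x i • m) = x i • δ j m + if i = j then m else 0)
    {z : Finset ι → M} (hz : koszulD sgn x z = 0) (I : Finset ι) :
    koszulD sgn x (∑ j, wedge sgn j fun I => δ j (z I)) I =
      ∑ j, x j • δ j (z I) + I.card • z I := by
  have e₁ : ∀ j, (0 : Finset ι → M) =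
      (∑ i, x i • wedge sgn j (contract sgn i fun I => δ j (z I))) +
        wedge sgn j (contract sgn j z) := by
    intro j
    have h0 : (fun I => δ j (koszulD sgn x z I)) = 0 := by rw [hz]; ext; simp
    have : (fun I => δ j (koszulD sgn x z I)) =
        (∑ i, x i • contract sgn i fun I => δ j (z I)) + contract sgn j z := by
      ext I
      rw [koszulD_def]
      simp only [Pi.add_apply, Finset.sum_apply, map_sum, Pi.smul_apply, h, contract_comp,
        Finset.sum_add_distrib, Finset.sum_ite_eq', Finset.mem_univ, if_true]
    rw [h0] at this
    have := congrArg (wedge sgn j) this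
    simpa only [map_zero, map_add, map_sum, wedge_smul] using this
  have e₂ : koszulD sgn x (∑ j, wedge sgn j fun I => δ j (z I)) =
      ∑ j, ((∑ i, x i • (contract sgn i (wedge sgn j fun I => δ j (z I)) +
        wedge sgn j (contract sgn i fun I => δ j (z I)))) + wedge sgn j (contract sgn j z)) := by
    rw [map_sum]
    refine Finset.sum_congr rfl fun j _ => ?_
    rw [koszulD_def]
    simp only [smul_add, Finset.sum_add_distrib]
    rw [add_assoc, ← e₁ j, add_zero]
  have e₃ : ∀ j, (∑ i, x i • (contract sgn i (wedge sgn j fun I => δ j (z I)) +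
        wedge sgn j (contract sgn i fun I => δ j (z I)))) = fun I => x j • δ j (z I) := by
    intro j
    rw [Finset.sum_eq_single j]
    · ext I
      rw [Pi.smul_apply, Pi.add_apply, contract_wedge_self hs, wedge_contract_self hs]
      split_ifs <;> simp
    · intro i _ hij
      rw [wedge_contract hs i j hij, add_neg_cancel, smul_zero]
    · simp
  rw [e₂, Finset.sum_apply]
  simp only [e₃, Pi.add_apply, wedge_contract_self hs, Finset.sum_add_distrib]
  congr 1
  rw [Finset.sum_ite_mem, Finset.univ_inter, Finset.sum_const]

end Homotopy

/-! ### Division by variables in polynomial rings -/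

section Division

open MvPolynomial

variable {σ R : Type*} [CommRing R]

/-- Division by a variable, discarding the terms which are not divisible by it. -/
noncomputable def divX (j : σ) : MvPolynomial σ R →+ MvPolynomial σ R where
  toFun f := f.divMonomial (Finsupp.single j 1)
  map_zero' := zero_divMonomial _
  map_add' f g := add_divMonomial f g _

theorem coeff_divX (j : σ) (f : MvPolynomial σ R) (α : σ →₀ ℕ) :
    coeff α (divX j f) = coeff (Finsupp.single j 1 + α) f := coeff_divMonomial _ _ _

theorem divX_X_mul_self (j : σ) (f : MvPolynomial σ R) : divX j (X j * f) = f :=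
  X_mul_divMonomial j f

theorem coeff_X_mul_divX [DecidableEq σ] (j : σ) (f : MvPolynomial σ R) (α : σ →₀ ℕ) :
    coeff α (X j * divX j f) = if α j = 0 then 0 else coeff α f := by
  rw [coeff_X_mul']
  by_cases h : α j = 0
  · simp [h]
  · rw [if_pos (Finsupp.mem_support_iff.2 h), if_neg h, coeff_divX,
      add_tsub_cancel_of_le (Finsupp.single_le_iff.2 (Nat.one_le_iff_ne_zero.2 h))]

theorem divX_X_mul {i j : σ} (h : i ≠ j) (f : MvPolynomial σ R) :
    divX j (X i * f) = X i * divX j f := by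
  classical
  ext α
  rw [coeff_divX, coeff_X_mul', coeff_X_mul', coeff_divX]
  by_cases hi : α i = 0
  · rw [if_neg (by simp [hi, h.symm]), if_neg (by simp [hi])]
  · rw [if_pos (by simp [hi]), if_pos (by simp [hi]), add_tsub_assoc_of_le]
    rw [Finsupp.single_le_iff]
    exact Nat.one_le_iff_ne_zero.2 hi

theorem divX_comm (i j : σ) (f : MvPolynomial σ R) : divX i (divX j f) = divX j (divX i f) := by
  ext α
  rw [coeff_divX, coeff_divX, coeff_divX, coeff_divX, add_left_comm]

theorem eq_zero_of_divX {f : MvPolynomial σ R} (h0 : coeff 0 f = 0) (h : ∀ j, divX j f = 0) :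
    f = 0 := by
  ext α
  rcases eq_or_ne α 0 with rfl | hα
  · simpa using h0
  · obtain ⟨j, hj⟩ := Finsupp.ne_iff.1 hα
    rw [coeff_zero, ← add_tsub_cancel_of_le (Finsupp.single_le_iff.2 (Nat.one_le_iff_ne_zero.2 hj)),
      ← coeff_divX, h, coeff_zero]

/-- The map on polynomials which applies an additive map to the coefficients. -/
noncomputable def mapCoeff (g : R →+ R) : MvPolynomial σ R →+ MvPolynomial σ R where
  toFun f := ∑ α ∈ f.support, monomial α (g (coeff α f))
  map_zero' := by simp
  map_add' f h := by
    classical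
    ext β
    have : ∀ f : MvPolynomial σ R,
        coeff β (∑ α ∈ f.support, monomial α (g (coeff α f))) = g (coeff β f) := by
      intro f
      simp only [coeff_sum, coeff_monomial, Finset.sum_ite_eq', mem_support_iff]
      by_cases hf : coeff β f = 0 <;> simp [hf]
    rw [coeff_add, this, this, this, coeff_add, map_add]

theorem coeff_mapCoeff (g : R →+ R) (f : MvPolynomial σ R) (β : σ →₀ ℕ) :
    coeff β (mapCoeff g f) = g (coeff β f) := by
  classical
  change coeff β (∑ α ∈ f.support, monomial α (g (coeff α f))) = g (coeff β f)
  simp only [coeff_sum, coeff_monomial, Finset.sum_ite_eq', mem_support_iff]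
  by_cases hf : coeff β f = 0 <;> simp [hf]

/-- The extension of an ideal to a polynomial ring. -/
noncomputable abbrev extendC (σ : Type*) (U : Ideal R) : Ideal (MvPolynomial σ R) :=
  U.map (C : R →+* MvPolynomial σ R)

/-- Membership is tested one coefficient at a time: a lower bound on the degree in `σ` and a
condition in `U`, independent of each other. The intersection formula and the stability under
division both come from this. -/
theorem mem_pow_idealOfVars_mul_map_C {U : Ideal R} {p : ℕ} {f : MvPolynomial σ R} :
    f ∈ idealOfVars σ R ^ p * extendC σ U ↔
      (∀ α, coeff α f ∈ U) ∧ ∀ α : σ →₀ ℕ, α.degree < p → coeff α f = 0 := by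
  constructor
  · intro h
    obtain ⟨h₁, h₂⟩ := Ideal.mul_le_inf h
    exact ⟨mem_map_C_iff.1 h₂, (mem_pow_idealOfVars_iff' p f).1 h₁⟩
  · rintro ⟨h₁, h₂⟩
    rw [f.as_sum]
    refine Ideal.sum_mem _ fun α hα => ?_
    rw [← mul_one (coeff α f), ← C_mul_monomial, mul_comm (C (coeff α f))]
    refine Ideal.mul_mem_mul ?_ (Ideal.mem_map_of_mem _ (h₁ α))
    rw [mem_pow_idealOfVars_iff']
    intro β hβ
    classical
    rw [coeff_monomial, if_neg]
    rintro rfl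
    exact mem_support_iff.1 hα (h₂ _ hβ)

theorem pow_idealOfVars_inf_map_C (U : Ideal R) (p : ℕ) :
    idealOfVars σ R ^ p ⊓ extendC σ U = idealOfVars σ R ^ p * extendC σ U :=
  le_antisymm (fun f hf => mem_pow_idealOfVars_mul_map_C.2
    ⟨mem_map_C_iff.1 hf.2, (mem_pow_idealOfVars_iff' p f).1 hf.1⟩) Ideal.mul_le_inf

theorem X_mul_divX_mem {U : Ideal R} {p : ℕ} {f : MvPolynomial σ R} (j : σ)
    (hf : f ∈ idealOfVars σ R ^ p * extendC σ U) :
    X j * divX j f ∈ idealOfVars σ R ^ p * extendC σ U := by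
  classical
  rw [mem_pow_idealOfVars_mul_map_C] at hf ⊢
  refine ⟨fun α => ?_, fun α hα => ?_⟩ <;> rw [coeff_X_mul_divX] <;> split_ifs
  exacts [U.zero_mem, hf.1 α, rfl, hf.2 α hα]

theorem divX_mem {U : Ideal R} {p : ℕ} {f : MvPolynomial σ R} (j : σ)
    (hf : f ∈ idealOfVars σ R ^ (p + 1) * extendC σ U) :
    divX j f ∈ idealOfVars σ R ^ p * extendC σ U := by
  rw [mem_pow_idealOfVars_mul_map_C] at hf ⊢
  refine ⟨fun α => ?_, fun α hα => ?_⟩ <;> rw [coeff_divX]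
  · exact hf.1 _
  · refine hf.2 _ ?_
    rw [map_add, Finsupp.degree_single]
    omega

end Division

/-! ### Koszul homology over polynomial rings -/

section KoszulPolynomial

open MvPolynomial

variable {σ τ R : Type*} [CommRing R]

variable (σ τ R) in
/-- The variables of the polynomial ring `R[τ][σ]`. -/
noncomputable def sumVars : σ ⊕ τ → MvPolynomial σ (MvPolynomial τ R) :=
  Sum.elim X fun j => C (X j)

/-- Division by the variables of the polynomial ring `R[τ][σ]`. -/
noncomputable def divSum : σ ⊕ τ →
    MvPolynomial σ (MvPolynomial τ R) →+ MvPolynomial σ (MvPolynomial τ R) :=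
  Sum.elim divX fun j => mapCoeff (divX j)

theorem divSum_self (j : σ ⊕ τ) (f : MvPolynomial σ (MvPolynomial τ R)) :
    divSum j (sumVars σ τ R j • f) = f := by
  rcases j with j | j
  · exact divX_X_mul_self j f
  · ext1 α
    simp only [divSum, sumVars, Sum.elim_inr, smul_eq_mul, coeff_mapCoeff, coeff_C_mul,
      divX_X_mul_self]

theorem divSum_of_ne (i j : σ ⊕ τ) (f : MvPolynomial σ (MvPolynomial τ R)) (h : i ≠ j) :
    divSum j (sumVars σ τ R i • f) = sumVars σ τ R i • divSum j f := by
  rcases i with i | i <;> rcases j with j | j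
  · exact divX_X_mul (fun e => h (by rw [e])) f
  · classical
    ext1 α
    simp only [divSum, sumVars, Sum.elim_inr, Sum.elim_inl, smul_eq_mul, coeff_mapCoeff,
      coeff_X_mul']
    split_ifs <;> simp
  · ext1 α
    simp only [divSum, sumVars, Sum.elim_inr, Sum.elim_inl, smul_eq_mul, coeff_divX, coeff_C_mul]
  · ext1 α
    simp only [divSum, sumVars, Sum.elim_inr, smul_eq_mul, coeff_mapCoeff, coeff_C_mul]
    exact divX_X_mul (fun e => h (by rw [e])) _

theorem divSum_comm (i j : σ ⊕ τ) (f : MvPolynomial σ (MvPolynomial τ R)) :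
    divSum i (divSum j f) = divSum j (divSum i f) := by
  rcases i with i | i <;> rcases j with j | j
  · exact divX_comm i j f
  all_goals
    ext1 α
    simp only [divSum, Sum.elim_inr, Sum.elim_inl, coeff_mapCoeff, coeff_divX]
  exact divX_comm i j _

variable [Fintype σ] [DecidableEq σ] [Fintype τ] [DecidableEq τ]

/-- Division by a variable lowers the order by one, and a polynomial without constant term that no
variable divides in any term is zero. -/
theorem koszulZ_le_koszulB_pow_idealOfVars {sgn : σ → Finset σ → ℤ} (hs : IsKoszulSign sgn)
    (p a : ℕ) :
    koszulZ sgn (X : σ → MvPolynomial σ R) a (idealOfVars σ R ^ (p + 1)) ≤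
      koszulB sgn X a (idealOfVars σ R ^ p) := by
  have hC : ∀ q, idealOfVars σ R ^ q = idealOfVars σ R ^ q * extendC σ (⊤ : Ideal R) := fun q => by
    rw [extendC, Ideal.map_top, Ideal.mul_top]
  refine koszulZ_le_koszulB_of_division hs divX Finset.univ (fun j m => by rw [smul_eq_mul, divX_X_mul_self])
    (fun i j m h => by rw [smul_eq_mul, smul_eq_mul, divX_X_mul h]) divX_comm (fun j _ m hm => ?_) (fun j _ m hm => ?_)
    (fun m hm h => ?_) a
  · rw [hC] at hm ⊢
    rw [smul_eq_mul]
    exact X_mul_divX_mem j hm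
  · rw [hC] at hm ⊢
    exact divX_mem j hm
  · exact eq_zero_of_divX ((mem_pow_idealOfVars_iff' _ _).1 hm 0 (by simp))
      fun j => h j (Finset.mem_univ j)

theorem koszulAcyclic_sumVars {sgn : σ ⊕ τ → Finset (σ ⊕ τ) → ℤ} (hs : IsKoszulSign sgn) :
    KoszulAcyclic sgn (sumVars σ τ R) (MvPolynomial σ (MvPolynomial τ R)) :=
  koszulAcyclic_of_division hs divSum divSum_self divSum_of_ne divSum_comm

theorem koszulZ_le_koszulB_sumVars {sgn : σ ⊕ τ → Finset (σ ⊕ τ) → ℤ} (hs : IsKoszulSign sgn)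
    (U : Ideal (MvPolynomial τ R)) (p a : ℕ) :
    koszulZ sgn (sumVars σ τ R) a (idealOfVars σ (MvPolynomial τ R) ^ (p + 1) * extendC σ U) ≤
      koszulB sgn (sumVars σ τ R) a (idealOfVars σ (MvPolynomial τ R) ^ p * extendC σ U) := by
  refine koszulZ_le_koszulB_of_division hs divSum (Finset.univ.image Sum.inl) divSum_self
    divSum_of_ne divSum_comm (fun j hj m hm => ?_) (fun j hj m hm => ?_) (fun m hm h => ?_) a
  · obtain ⟨j, -, rfl⟩ := Finset.mem_image.1 hj
    exact X_mul_divX_mem j hm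
  · obtain ⟨j, -, rfl⟩ := Finset.mem_image.1 hj
    exact divX_mem j hm
  · exact eq_zero_of_divX ((mem_pow_idealOfVars_mul_map_C.1 hm).2 0 (by simp))
      fun j => h (Sum.inl j) (Finset.mem_image_of_mem _ (Finset.mem_univ j))

end KoszulPolynomial

/-! ### Künneth -/

section LinearHomotopy

/-- A map of complexes of vector spaces which is zero on homology is null-homotopic. -/
theorem exists_linear_homotopy {k F : Type*} [Field k] [AddCommGroup F] [Module k F]
    (d : F →ₗ[k] F) (hd : ∀ f, d (d f) = 0) (C C' : Submodule k F) (hC : ∀ c ∈ C, d c ∈ C)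
    (hCC : C ≤ C') (h : ∀ z ∈ C, d z = 0 → ∃ w ∈ C', d w = z) :
    ∃ η : F →ₗ[k] F, ∀ c ∈ C, η c ∈ C' ∧ d (η c) + η (d c) = c := by
  let dC : C →ₗ[k] C := d.restrict hC
  obtain ⟨r, hr⟩ := dC.rangeRestrict.exists_rightInverse_of_surjective dC.range_rangeRestrict
  obtain ⟨p, hp⟩ := (LinearMap.range dC).subtype.exists_leftInverse_of_injective
    (Submodule.ker_subtype _)
  obtain ⟨q, hq⟩ := C.subtype.exists_leftInverse_of_injective (Submodule.ker_subtype _)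
  -- Over a field the differential has a generalized inverse `s`, with `d s d = d`.
  let s : C →ₗ[k] C := r ∘ₗ p
  have hs : ∀ c, dC (s (dC c)) = dC c := fun c => by
    have h1 : p (dC c) = dC.rangeRestrict c := LinearMap.congr_fun hp (dC.rangeRestrict c)
    have h2 := LinearMap.congr_fun hr (dC.rangeRestrict c)
    change dC (r (p (dC c))) = dC c
    rw [h1]
    exact congrArg Subtype.val h2
  have hdd : ∀ c, dC (dC c) = 0 := fun c => Subtype.ext (hd c)
  let f : C' →ₗ[k] F := d ∘ₗ C'.subtype
  let ζ : LinearMap.ker dC →ₗ[k] LinearMap.range f :=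
    (C.subtype ∘ₗ (LinearMap.ker dC).subtype).codRestrict _ fun z => by
      obtain ⟨w, hw, hwz⟩ := h z.1 z.1.2 (congrArg Subtype.val z.2)
      exact ⟨⟨w, hw⟩, hwz⟩
  -- `g` chooses primitives in `C'` linearly, for all cycles of `C` at once.
  obtain ⟨g, hg⟩ := Module.projective_lifting_property f.rangeRestrict ζ f.surjective_rangeRestrict
  have hg' : ∀ z, d (g z) = z.1 := fun z => congrArg Subtype.val (LinearMap.congr_fun hg z)
  let e : C →ₗ[k] C := LinearMap.id - s ∘ₗ dC
  have he : ∀ c, dC (e c) = 0 := fun c => by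
    change dC (c - s (dC c)) = 0
    rw [map_sub, hs, sub_self]
  -- `e` projects onto cycles, and `u` further removes the boundary part, so that `u` kills
  -- boundaries.
  let u : C →ₗ[k] LinearMap.ker dC := (e - dC ∘ₗ s ∘ₗ e).codRestrict _ fun c => by
    change dC (e c - dC (s (e c))) = 0
    rw [map_sub, he, hdd, sub_self]
  -- The two summands handle the homology part and the boundary part of `e c`; together they give `d
  -- η = e` and `η d = s d`, whose sum is the identity because `e = 1 - s d`.
  let η : C →ₗ[k] F := C'.subtype ∘ₗ g ∘ₗ u + C.subtype ∘ₗ s ∘ₗ dC ∘ₗ s ∘ₗ e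
  have hη : ∀ c : C, d (η c) + η (dC c) = c := by
    intro c
    have h1 : e (dC c) = dC c := by
      change dC c - s (dC (dC c)) = dC c
      rw [hdd, map_zero, sub_zero]
    have h2 : u (dC c) = 0 := by
      refine Subtype.ext ?_
      change e (dC c) - dC (s (e (dC c))) = 0
      rw [h1, hs, sub_self]
    have h3 : η (dC c) = s (dC c) := by
      change (g (u (dC c)) : F) + s (dC (s (e (dC c)))) = s (dC c)
      rw [h2, h1, hs, map_zero, Submodule.coe_zero, zero_add]
    have h4 : d (η c) = e c := by
      change d ((g (u c) : F) + s (dC (s (e c)))) = e c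
      have h5 : d (s (dC (s (e c))) : C) = dC (s (e c)) := congrArg Subtype.val (hs (s (e c)))
      rw [map_add, hg', h5]
      change ((e c - dC (s (e c)) : C) : F) + dC (s (e c)) = e c
      rw [Submodule.coe_sub, sub_add_cancel]
    rw [h3, h4]
    change ((c - s (dC c) : C) : F) + s (dC c) = c
    rw [Submodule.coe_sub, sub_add_cancel]
  have hq' : ∀ c : C, q c = c := fun c => LinearMap.congr_fun hq c
  refine ⟨η ∘ₗ q, fun c hc => ⟨?_, ?_⟩⟩
  · rw [LinearMap.comp_apply, show q c = ⟨c, hc⟩ from hq' ⟨c, hc⟩]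
    exact add_mem (Subtype.prop _) (hCC (Subtype.prop _))
  · rw [LinearMap.comp_apply, LinearMap.comp_apply, show q c = ⟨c, hc⟩ from hq' ⟨c, hc⟩,
      show q (d c) = dC ⟨c, hc⟩ from hq' (dC ⟨c, hc⟩)]
    exact hη ⟨c, hc⟩

end LinearHomotopy

section SumSign

variable {σ τ : Type*} [DecidableEq σ] [DecidableEq τ]

/-- The signs for exterior products over a disjoint union. -/
def sumSign (sgnσ : σ → Finset σ → ℤ) (sgnτ : τ → Finset τ → ℤ) :
    σ ⊕ τ → Finset (σ ⊕ τ) → ℤ :=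
  Sum.elim (fun i K => sgnσ i K.toLeft) fun j K => (-1) ^ K.toLeft.card * sgnτ j K.toRight

/-- The indices in `σ` come before those in `τ`, so a vector indexed by `τ` first moves past all
`σ`-indices present. -/
theorem isKoszulSign_sumSign {sgnσ : σ → Finset σ → ℤ} {sgnτ : τ → Finset τ → ℤ}
    (hσ : IsKoszulSign sgnσ) (hτ : IsKoszulSign sgnτ) : IsKoszulSign (sumSign sgnσ sgnτ) where
  mul_self i I := by
    rcases i with i | i
    · exact hσ.mul_self _ _
    · simp only [sumSign, Sum.elim_inr]
      rw [mul_mul_mul_comm, hτ.mul_self, ← pow_add, ← two_mul, pow_mul]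
      simp
  anticomm i j I hij hi hj := by
    rcases i with i | i <;> rcases j with j | j <;>
      simp only [sumSign, Sum.elim_inr, Sum.elim_inl, Finset.toLeft_insert_inl,
        Finset.toLeft_insert_inr, Finset.toRight_insert_inl, Finset.toRight_insert_inr]
    · exact hσ.anticomm i j _ (fun h => hij (by rw [h])) (by simpa using hi) (by simpa using hj)
    · rw [Finset.card_insert_of_notMem (by simpa using hi)]
      ring
    · rw [Finset.card_insert_of_notMem (by simpa using hj)]
      ring
    · rw [mul_mul_mul_comm, hτ.anticomm i j _ (fun h => hij (by rw [h])) (by simpa using hi)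
        (by simpa using hj)]
      ring

end SumSign

/-! ### Koszul chains over `S[σ]` as families of chains over `S` -/

section Kunneth

open MvPolynomial

variable {σ τ S : Type*} [CommRing S] [DecidableEq σ] [DecidableEq τ]

/-- The coefficient of a Koszul chain over `S[σ]` at a form and a monomial in the variables `σ`,
a Koszul chain over `S`. -/
noncomputable def koszulCoeff (f : Finset (σ ⊕ τ) → MvPolynomial σ S) (I : Finset σ) (α : σ →₀ ℕ) :
    Finset τ → S := fun L => coeff α (f (I.disjSum L))

variable [Fintype σ] [Fintype τ]

/-- The differential splits into a part that moves between the pairs `(I, α)` and, up to sign, the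
Koszul differential over `S` inside each fibre. -/
theorem koszulCoeff_koszulD {sgnσ : σ → Finset σ → ℤ} {sgnτ : τ → Finset τ → ℤ} (y : τ → S)
    (f : Finset (σ ⊕ τ) → MvPolynomial σ S) (I : Finset σ) (α : σ →₀ ℕ) :
    koszulCoeff (koszulD (sumSign sgnσ sgnτ) (Sum.elim X fun j => C (y j)) f) I α =
      (∑ i, if i ∈ I ∨ α i = 0 then 0 else
        sgnσ i I • koszulCoeff f (insert i I) (α - Finsupp.single i 1)) +
      (-1 : ℤ) ^ I.card • koszulD sgnτ y (koszulCoeff f I α) := by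
  ext L
  simp only [koszulCoeff, koszulD_apply, Pi.add_apply, Pi.smul_apply, Fintype.sum_sum_type,
    coeff_add, coeff_sum, Finset.sum_apply, Finset.smul_sum]
  congr 1
  · refine Finset.sum_congr rfl fun i _ => ?_
    have hins : insert (Sum.inl i) (I.disjSum L) = (insert i I).disjSum L :=
      Finset.eq_disjSum_iff.2 (by simp)
    by_cases hi : i ∈ I
    · simp [hi]
    · by_cases h : α i = 0 <;>
        simp [hi, h, hins, sumSign, coeff_X_mul', koszulCoeff, -zsmul_eq_mul, coeff_smul]
  · refine Finset.sum_congr rfl fun j _ => ?_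
    have hins : insert (Sum.inr j) (I.disjSum L) = I.disjSum (insert j L) :=
      Finset.eq_disjSum_iff.2 (by simp)
    by_cases hj : j ∈ L
    · simp [hj]
    · simp only [Finset.inr_mem_disjSum, hj, if_false, hins, sumSign, Sum.elim_inr,
        Finset.toLeft_disjSum, Finset.toRight_disjSum, smul_eq_mul, coeff_C_mul, coeff_smul,
        mul_smul]
      rw [mul_smul_comm]

/-- A null-homotopy over `S` extends to the Koszul complex over `S[σ]`. -/
theorem koszulZ_le_koszulB_of_homotopy {sgnσ : σ → Finset σ → ℤ} {sgnτ : τ → Finset τ → ℤ}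
    (y : τ → S) {U V : Ideal S} (η : (Finset τ → S) →+ (Finset τ → S))
    (hη : ∀ c, (∀ L, c L ∈ U) → (∀ L, η c L ∈ V) ∧
      koszulD sgnτ y (η c) + η (koszulD sgnτ y c) = c) (p a : ℕ) :
    koszulZ (sumSign sgnσ sgnτ) (Sum.elim X fun j => C (y j)) a
        (idealOfVars σ S ^ p * extendC σ U) ≤
      koszulB (sumSign sgnσ sgnτ) (Sum.elim X fun j => C (y j)) a
        (idealOfVars σ S ^ p * extendC σ V) := by
  intro z hz
  let s : Finset (σ →₀ ℕ) := Finset.univ.biUnion fun K => (z K).support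
  have hs : ∀ α, α ∉ s → ∀ I, koszulCoeff z I α = 0 := fun α hα I => by
    ext L
    by_contra h0
    exact hα (Finset.mem_biUnion.2 ⟨_, Finset.mem_univ _, mem_support_iff.2 h0⟩)
  have hU : ∀ I α L, koszulCoeff z I α L ∈ U := fun I α L =>
    (mem_pow_idealOfVars_mul_map_C.1 (hz.1.1 _)).1 α
  have hp : ∀ (I : Finset σ) (α : σ →₀ ℕ), α.degree < p → koszulCoeff z I α = 0 := fun I α hα => by
    ext L
    exact (mem_pow_idealOfVars_mul_map_C.1 (hz.1.1 _)).2 α hα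
  -- `η` is applied in each fibre. The sign `(-1)^|I|` makes it anticommute with the part of the
  -- differential that moves between fibres, so only the fibrewise homotopy identity remains.
  let w : Finset (σ ⊕ τ) → MvPolynomial σ S := fun K => ∑ α ∈ s, monomial α
    (((-1 : ℤ) ^ K.toLeft.card • η (koszulCoeff z K.toLeft α)) K.toRight)
  have hw : ∀ K α, coeff α (w K) =
      ((-1 : ℤ) ^ K.toLeft.card • η (koszulCoeff z K.toLeft α)) K.toRight := by
    intro K α
    simp only [w, coeff_sum, coeff_monomial, Finset.sum_ite_eq']
    split_ifs with h
    · rfl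
    · rw [hs α h, map_zero, smul_zero]
      rfl
  have hw' : ∀ I α, koszulCoeff w I α = (-1 : ℤ) ^ I.card • η (koszulCoeff z I α) := by
    intro I α
    ext L
    rw [koszulCoeff, hw, Finset.toLeft_disjSum, Finset.toRight_disjSum]
  -- `η` is not assumed to raise the exterior degree by exactly one, so the component of degree `a +
  -- 1` is extracted.
  refine exists_koszulK_of_koszulD_eq _ _ (w := w) hz.1.2 (fun K => ?_) ?_
  · rw [mem_pow_idealOfVars_mul_map_C]
    refine ⟨fun α => ?_, fun α hα => ?_⟩ <;> rw [hw]
    · exact zsmul_mem ((hη _ (hU _ _)).1 _) _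
    · rw [hp _ α hα, map_zero, smul_zero]
      rfl
  · have key : ∀ I α, koszulCoeff (koszulD (sumSign sgnσ sgnτ)
        (Sum.elim X fun j => C (y j)) w) I α = koszulCoeff z I α := by
      intro I α
      have h0 := koszulCoeff_koszulD (sgnσ := sgnσ) (sgnτ := sgnτ) y z I α
      have hz0 : koszulD (sumSign sgnσ sgnτ) (Sum.elim X fun j => C (y j)) z = 0 := hz.2
      have hz1 : koszulCoeff (0 : Finset (σ ⊕ τ) → MvPolynomial σ S) I α = 0 := by
        ext L
        simp [koszulCoeff]
      rw [hz0, hz1] at h0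
      have h1 := congrArg η h0
      rw [map_zero, map_add, map_sum, map_zsmul] at h1
      rw [koszulCoeff_koszulD, hw']
      have h2 : (∑ i, if i ∈ I ∨ α i = 0 then 0 else
          sgnσ i I • koszulCoeff w (insert i I) (α - Finsupp.single i 1)) =
          -((-1 : ℤ) ^ I.card • ∑ i, η (if i ∈ I ∨ α i = 0 then 0 else
            sgnσ i I • koszulCoeff z (insert i I) (α - Finsupp.single i 1))) := by
        rw [Finset.smul_sum, ← Finset.sum_neg_distrib]
        refine Finset.sum_congr rfl fun i _ => ?_
        split_ifs with h
        · simp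
        · rw [not_or] at h
          rw [hw', Finset.card_insert_of_notMem h.1, map_zsmul, smul_comm, pow_succ, mul_neg_one,
            neg_smul]
      rw [h2, eq_neg_of_add_eq_zero_left h1.symm, smul_neg, neg_neg, smul_smul, map_zsmul,
        smul_smul, ← mul_pow, neg_one_mul, neg_neg, one_pow, one_smul, one_smul, add_comm]
      exact (hη _ (hU _ _)).2
    ext1 K
    ext α
    have := congrFun (key K.toLeft α) K.toRight
    simpa only [koszulCoeff, Finset.toLeft_disjSum_toRight] using this

end Kunneth

/-! ### Maps which are zero on Koszul homology -/

section KoszulUngraded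

variable {ι : Type*} [DecidableEq ι] [Fintype ι] {sgn : ι → Finset ι → ℤ}
  {A : Type*} [CommRing A] {x : ι → A} {M : Type*} [AddCommGroup M] [Module A M]

/-- The homogeneous parts of a cycle are cycles, so primitives can be added over all degrees. This
ungraded form is the one suited to `exists_linear_homotopy`. -/
theorem exists_koszulD_eq_of_koszulZ_le {U V : Submodule A M}
    (h : ∀ a, koszulZ sgn x a U ≤ koszulB sgn x a V) {z : Finset ι → M} (hz : ∀ I, z I ∈ U)
    (hdz : koszulD sgn x z = 0) : ∃ w, (∀ I, w I ∈ V) ∧ koszulD sgn x w = z := by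
  have key : ∀ a, ∃ w ∈ koszulK ι (a + 1) V,
      koszulD sgn x w = fun I => if I.card = a then z I else 0 := by
    intro a
    refine h a (x := fun I => if I.card = a then z I else 0)
      ⟨⟨fun I => ?_, fun I hI => if_neg hI⟩, ?_⟩
    · dsimp only
      split_ifs
      exacts [hz I, U.zero_mem]
    · change koszulD sgn x _ = 0
      ext I
      rw [koszulD_apply]
      by_cases hI : I.card + 1 = a
      · rw [← congrFun hdz I, koszulD_apply]
        refine Finset.sum_congr rfl fun i _ => ?_
        split_ifs with h1 h2
        · rfl
        · rfl
        · exact absurd (by rw [Finset.card_insert_of_notMem h1, hI]) h2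
      · refine Finset.sum_eq_zero fun i _ => ?_
        split_ifs with h1 h2
        · rfl
        · rw [Finset.card_insert_of_notMem h1] at h2
          exact absurd h2 hI
        · simp
  choose w hw hwz using key
  refine ⟨∑ a ∈ Finset.range (Fintype.card ι + 1), w a, fun I => ?_, ?_⟩
  · rw [Finset.sum_apply]
    exact V.sum_mem fun a _ => (hw a).1 I
  · rw [map_sum]
    ext I
    simp only [hwz, Finset.sum_apply, Finset.sum_ite_eq, Finset.mem_range]
    rw [if_pos (Nat.lt_succ_of_le (Finset.card_le_univ I))]

theorem koszulZ_pow_smul_le_pi {r : ℕ} (𝔫 : Ideal A)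
    (h : ∀ b a, koszulZ sgn x a (𝔫 ^ (b + 1)) ≤ koszulB sgn x a (𝔫 ^ b)) (b a : ℕ) :
    koszulZ sgn x a (𝔫 ^ (b + 1) • (⊤ : Submodule A (Fin r → A))) ≤
      koszulB sgn x a (𝔫 ^ b • (⊤ : Submodule A (Fin r → A))) := by
  have hpi : ∀ (I : Ideal A) (f : Fin r → A),
      f ∈ I • (⊤ : Submodule A (Fin r → A)) ↔ ∀ p, f p ∈ I := by
    intro I f
    constructor
    · intro hf p
      refine Submodule.smul_induction_on hf (fun c hc n _ => ?_) fun u v hu hv => ?_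
      · exact I.mul_mem_right _ hc
      · exact I.add_mem hu hv
    · intro hf
      rw [pi_eq_sum_univ' f]
      exact Submodule.sum_mem _ fun p _ => Submodule.smul_mem_smul (hf p) trivial
  intro z hz
  have key : ∀ p, ∃ w ∈ koszulK ι (a + 1) (𝔫 ^ b), koszulD sgn x w = fun I => z I p := by
    intro p
    refine h b a (x := fun I => z I p) ⟨⟨fun I => (hpi _ _).1 (hz.1.1 I) p, fun I hI => by
      simp [hz.1.2 I hI]⟩, ?_⟩
    have h0 : koszulD sgn x z = 0 := hz.2
    have := koszulD_comp sgn x (LinearMap.proj p : (Fin r → A) →ₗ[A] A) z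
    rw [h0] at this
    exact this
  choose w hw hwz using key
  refine ⟨fun I p => w p I, ⟨fun I => (hpi _ _).2 fun p => (hw p).1 I, fun I hI => ?_⟩, ?_⟩
  · ext p
    exact (hw p).2 I hI
  · ext I p
    have := koszulD_comp sgn x (LinearMap.proj p : (Fin r → A) →ₗ[A] A) fun I p => w p I
    exact (congrFun this I).symm.trans (congrFun (hwz p) I)

theorem koszulZ_zero_le (hs : IsKoszulSign sgn) (N : Submodule A M) (b : ℕ) :
    koszulZ sgn x 0 (Ideal.span (Set.range x) ^ (b + 1) • N) ≤
      koszulB sgn x 0 (Ideal.span (Set.range x) ^ b • N) := by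
  intro z hz
  rw [koszulB_zero_iff hs hz.1.2, ← Submodule.smul_assoc, smul_eq_mul, ← pow_succ']
  exact hz.1.1 ∅

/-- A cycle lifts to a chain in `𝔫^(b+1) M` whose boundary lies in `𝔫^(b+1) ker f` by `hf`. That
boundary also bounds a chain in `𝔫^b ker f`, which minimality places back in `𝔫^(b+1) M`. The
difference of the two chains is a cycle of `M`; the image under `f` of a primitive of it bounds the
original cycle. -/
theorem koszulZ_succ_le_of_ker (hs : IsKoszulSign sgn) {N : Type*} [AddCommGroup N] [Module A N]
    (f : M →ₗ[A] N) {𝔫 : Ideal A} (h𝔫 : 𝔫 = Ideal.span (Set.range x))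
    (hM : ∀ b a, koszulZ sgn x a (𝔫 ^ (b + 1) • (⊤ : Submodule A M)) ≤
      koszulB sgn x a (𝔫 ^ b • (⊤ : Submodule A M)))
    (hf : ∀ b, LinearMap.ker f ⊓ 𝔫 ^ (b + 1) • ⊤ ≤ 𝔫 ^ b • LinearMap.ker f)
    (hmin : LinearMap.ker f ≤ 𝔫 • ⊤) {a : ℕ}
    (hker : ∀ b, koszulZ sgn x a (𝔫 ^ (b + 1) • LinearMap.ker f) ≤
      koszulB sgn x a (𝔫 ^ b • LinearMap.ker f)) (b : ℕ) :
    koszulZ sgn x (a + 1) (𝔫 ^ (b + 1) • LinearMap.range f) ≤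
      koszulB sgn x (a + 1) (𝔫 ^ b • LinearMap.range f) := by
  intro z hz
  have hrange : ∀ I : Ideal A, I • LinearMap.range f = (I • ⊤ : Submodule A M).map f := fun I => by
    rw [Submodule.map_smul'', Submodule.map_top]
  rw [hrange] at hz
  obtain ⟨z', hz', rfl⟩ := exists_koszulK_lift f _ hz.1
  have h0 : koszulD sgn x (fun I => f (z' I)) = 0 := hz.2
  rw [koszulD_comp] at h0
  have hd : koszulD sgn x z' ∈ koszulZ sgn x a (𝔫 ^ (b + 1) • LinearMap.ker f) := by
    refine ⟨⟨fun I => hf (b + 1) ⟨congrFun h0 I, ?_⟩, (koszulD_mem sgn x hz').2⟩,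
      koszulD_koszulD x hs z'⟩
    have := koszulD_apply_mem_smul sgn x hz'.1 I
    rwa [← h𝔫, ← Submodule.smul_assoc, smul_eq_mul, ← pow_succ'] at this
  obtain ⟨w, hw, hwz⟩ := hker b hd
  have hw' : w ∈ koszulK ι (a + 1) (𝔫 ^ (b + 1) • (⊤ : Submodule A M)) := by
    refine koszulK_mono ?_ hw
    rw [pow_succ, ← smul_eq_mul, Submodule.smul_assoc]
    exact Submodule.smul_mono le_rfl hmin
  obtain ⟨v, hv, hvz⟩ := hM b (a + 1) (x := z' - w) ⟨sub_mem hz' hw', by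
    change koszulD sgn x _ = 0
    rw [map_sub, hwz, sub_self]⟩
  refine ⟨fun I => f (v I), ⟨fun I => ?_, fun I hI => by simp [hv.2 I hI]⟩, ?_⟩
  · rw [hrange]
    exact ⟨_, hv.1 I, rfl⟩
  · rw [koszulD_comp, hvz]
    ext I
    have : f (w I) = 0 := (Submodule.smul_le_right (I := 𝔫 ^ b)) (hw.1 I)
    simp [this]

end KoszulUngraded

/-! ### Koszul ideals: `𝔫^(b+1) M → 𝔫^b M` is zero on Koszul homology -/

section KoszulIdeal

open MvPolynomial

variable {τ k : Type*} [Field k] {M : Ideal (MvPolynomial τ k)}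

theorem MinimalGradedFreeResolution.linHomologyVanishes_succ (X : MinimalGradedFreeResolution M)
    (h : X.linearityDefect = 0) (i : ℕ) : X.LinHomologyVanishes (i + 1) := by
  by_contra hi
  have : ((i + 1 : ℕ) : ℕ∞) ≤ X.linearityDefect :=
    le_iSup₂ (f := fun (i : ℕ) (_ : i ∈ {i : ℕ | ¬ X.LinHomologyVanishes i}) => (i : ℕ∞)) (i + 1) hi
  rw [h] at this
  simp at this

/-- A preimage of `y` is pushed one power of `𝔫` deeper at a time: while its image has order at
least two higher, it is a cycle of the linear part, hence a boundary modulo the next power, and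
boundaries do not affect the image. -/
theorem MinimalGradedFreeResolution.range_d_inf_le (X : MinimalGradedFreeResolution M)
    (h : X.linearityDefect = 0) (i b : ℕ) :
    LinearMap.range (X.d i) ⊓ idealOfVars τ k ^ (b + 1) • ⊤ ≤
      idealOfVars τ k ^ b • LinearMap.range (X.d i) := by
  rintro y ⟨⟨x, rfl⟩, hy⟩
  have key : ∀ c ≤ b, ∃ x' ∈ (idealOfVars τ k ^ c • ⊤ : Submodule (MvPolynomial τ k)
      (Fin (X.rank (i + 1)) → MvPolynomial τ k)), X.d i x' = X.d i x := by
    intro c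
    induction c with
    | zero => exact fun _ => ⟨x, by rw [pow_zero, Ideal.one_eq_top, Submodule.top_smul]; trivial, rfl⟩
    | succ c ih =>
      intro hc
      obtain ⟨x', hx', e⟩ := ih (by omega)
      -- The index `c + i + 1` is the one for which the filtration is `𝔫^c` on `X (i + 1)`, while
      -- the next step of the filtration is `𝔫^(c+2)` on `X i`.
      have hmem : x' ∈ X.linCycles (c + i + 1) (i + 1) := by
        refine ⟨?_, ?_⟩
        · rw [SetLike.mem_coe, filt, show c + i + 1 - (i + 1) = c by omega]
          exact hx'
        · rw [SetLike.mem_coe, Submodule.mem_comap, e, filt,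
            show c + i + 1 + 1 - i = c + 2 by omega]
          exact Submodule.smul_mono_left (Ideal.pow_le_pow_right (by omega)) hy
      obtain ⟨_, ⟨u, -, rfl⟩, v, hv, huv⟩ :=
        Submodule.mem_sup.1 (X.linHomologyVanishes_succ h i _ hmem)
      rw [filt, show c + i + 1 + 1 - (i + 1) = c + 1 by omega] at hv
      refine ⟨v, hv, ?_⟩
      have h0 : X.d i (X.d (i + 1) u) = 0 := by
        rw [← LinearMap.mem_ker, X.exact_succ]
        exact ⟨u, rfl⟩
      rw [← e, ← huv, map_add, h0, zero_add]
  obtain ⟨x', hx', e⟩ := key b le_rfl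
  rw [← e, ← Submodule.map_top, ← Submodule.map_smul'']
  exact ⟨x', hx', rfl⟩

variable [Fintype τ] [DecidableEq τ] {sgn : τ → Finset τ → ℤ}

/-- Induction on the Koszul degree, passing from each image in the minimal resolution to the next
syzygy. All syzygies and all `b` are treated together. -/
theorem IsKoszulIdeal.koszulZ_le (hs : IsKoszulSign sgn) (hM : IsKoszulIdeal M) (b a : ℕ) :
    koszulZ sgn X a (idealOfVars τ k ^ (b + 1) * M) ≤
      koszulB sgn X a (idealOfVars τ k ^ b * M) := by
  obtain ⟨Y, hY⟩ := hM
  have hfree : ∀ r b a, koszulZ sgn X a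
      (idealOfVars τ k ^ (b + 1) • (⊤ : Submodule _ (Fin r → MvPolynomial τ k))) ≤
        koszulB sgn X a (idealOfVars τ k ^ b • ⊤) := fun r =>
    koszulZ_pow_smul_le_pi _ (koszulZ_le_koszulB_pow_idealOfVars hs)
  have hd : ∀ a i b, koszulZ sgn X a (idealOfVars τ k ^ (b + 1) • LinearMap.range (Y.d i)) ≤
      koszulB sgn X a (idealOfVars τ k ^ b • LinearMap.range (Y.d i)) := by
    intro a
    induction a with
    | zero => exact fun i b => koszulZ_zero_le hs _ b
    | succ a ih =>
      intro i b
      refine koszulZ_succ_le_of_ker hs (Y.d i) rfl (hfree _) ?_ ?_ ?_ b <;> rw [Y.exact_succ]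
      exacts [Y.range_d_inf_le hY _, Y.minimal _, ih _]
  rw [← Y.range_aug, ← smul_eq_mul, ← smul_eq_mul]
  cases a with
  | zero => exact koszulZ_zero_le hs _ b
  | succ a =>
    refine koszulZ_succ_le_of_ker hs Y.aug rfl (hfree _) ?_ ?_ ?_ b <;> rw [Y.exact_zero]
    exacts [Y.range_d_inf_le hY _, Y.minimal _, hd a 0]

end KoszulIdeal

/-! ### Derivations and products of ideals -/

section Derivation

variable {S : Type*} [CommRing S]

/-- A Leibniz rule on a class of ideals gives inclusions for mixed products of powers. -/
theorem map_pow_mul_pow_mem (δ : S →+ S) (𝒞 : Ideal S → Prop)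
    (hmul : ∀ U₁ U₂, 𝒞 U₁ → 𝒞 U₂ → 𝒞 (U₁ * U₂))
    (hδ : ∀ U₁ U₂ V₁ V₂ : Ideal S, 𝒞 U₁ → 𝒞 U₂ → (∀ f ∈ U₁, δ f ∈ V₁) → (∀ f ∈ U₂, δ f ∈ V₂) →
      ∀ f ∈ U₁ * U₂, δ f ∈ V₁ * U₂ ⊔ U₁ * V₂)
    {𝔫 J : Ideal S} (h𝔫 : 𝒞 𝔫) (hJ : 𝒞 J) (hJ2 : J ≤ 𝔫 ^ 2) (p t : ℕ) :
    ∀ f ∈ 𝔫 ^ p * J ^ (t + 1), δ f ∈ 𝔫 ^ (p + 1) * J ^ t := by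
  -- Exponents start at one because `𝒞` is not assumed for the unit ideal; the case `p = 0` is
  -- separate for the same reason.
  have hpow : ∀ U, 𝒞 U → ∀ n, 𝒞 (U ^ (n + 1)) := by
    intro U hU n
    induction n with
    | zero => rwa [zero_add, pow_one]
    | succ n ih => exact hmul _ _ ih hU
  have hn : ∀ p, ∀ f ∈ 𝔫 ^ (p + 1), δ f ∈ 𝔫 ^ p := by
    intro p
    induction p with
    | zero => intro f _; simp
    | succ p ih =>
      intro f hf
      refine (sup_le ?_ ?_ : (_ : Ideal S) ≤ 𝔫 ^ (p + 1))
        (hδ _ _ _ ⊤ (hpow 𝔫 h𝔫 p) h𝔫 ih (fun _ _ => trivial) f hf)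
      · rw [← pow_succ]
      · rw [Ideal.mul_top]
  have hJ1 : ∀ f ∈ J, δ f ∈ 𝔫 := fun f hf => by simpa using hn 1 f (hJ2 hf)
  have hJt : ∀ t, ∀ f ∈ J ^ (t + 1), δ f ∈ 𝔫 * J ^ t := by
    intro t
    induction t with
    | zero => intro f hf; simpa using hJ1 f (by simpa using hf)
    | succ t ih =>
      intro f hf
      refine (sup_le ?_ ?_ : (_ : Ideal S) ≤ 𝔫 * J ^ (t + 1)) (hδ _ _ _ _ (hpow J hJ t) hJ ih hJ1 f hf)
      · rw [mul_assoc, ← pow_succ]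
      · rw [mul_comm]
  intro f hf
  cases p with
  | zero => simpa using hJt t f (by simpa using hf)
  | succ p =>
    refine (sup_le ?_ ?_ : (_ : Ideal S) ≤ 𝔫 ^ (p + 1 + 1) * J ^ t)
      (hδ _ _ _ _ (hpow 𝔫 h𝔫 p) (hpow J hJ t) (hn p) (hJt t) f hf)
    · rw [pow_succ' J, ← mul_assoc]
      refine Ideal.mul_mono_left ((Ideal.mul_mono_right hJ2).trans ?_)
      rw [← pow_add]
    · rw [← mul_assoc, ← pow_succ]

end Derivation

/-! ### Vanishing over `S`: division for ideals containing their terms, Euler's formula in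
characteristic zero -/

section PolynomialVanishing

open MvPolynomial

variable {τ k : Type*} [Field k]

/-- An ideal which contains the terms of its elements. -/
def ContainsTerms (U : Ideal (MvPolynomial τ k)) : Prop :=
  ∀ f ∈ U, ∀ α, monomial α (coeff α f) ∈ U

theorem IsMonomialIdeal.containsTerms {U : Ideal (MvPolynomial τ k)} (h : IsMonomialIdeal U) :
    ContainsTerms U := by
  obtain ⟨A, rfl⟩ := h
  intro f hf α
  rw [mem_ideal_span_monomial_image] at hf ⊢
  intro β hβ
  classical
  rw [mem_support_iff, coeff_monomial] at hβ
  split_ifs at hβ with h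
  · exact h ▸ hf α (mem_support_iff.2 hβ)
  · exact absurd rfl hβ

theorem containsTerms_idealOfVars : ContainsTerms (idealOfVars τ k) := by
  intro f hf α
  rw [← pow_one (idealOfVars τ k), mem_pow_idealOfVars_iff'] at hf ⊢
  intro β hβ
  classical
  rw [coeff_monomial]
  split_ifs with h
  · subst h
    exact hf α hβ
  · rfl

theorem ContainsTerms.mul {U₁ U₂ : Ideal (MvPolynomial τ k)} (h₁ : ContainsTerms U₁)
    (h₂ : ContainsTerms U₂) : ContainsTerms (U₁ * U₂) := by
  classical
  intro f hf α
  refine Submodule.mul_induction_on hf (fun f hf g hg => ?_) fun f g hf hg => ?_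
  · rw [coeff_mul, map_sum]
    refine Ideal.sum_mem _ fun p hp => ?_
    rw [← Finset.HasAntidiagonal.mem_antidiagonal.1 hp, ← monomial_mul]
    exact Ideal.mul_mem_mul (h₁ f hf _) (h₂ g hg _)
  · rw [coeff_add, map_add]
    exact add_mem hf hg

theorem divX_monomial {j : τ} {α : τ →₀ ℕ} (h : α j = 0) (c : k) : divX j (monomial α c) = 0 := by
  classical
  ext β
  rw [coeff_divX, coeff_monomial, if_neg, coeff_zero]
  rintro rfl
  simp at h

theorem monomial_eq_X_mul {j : τ} {α : τ →₀ ℕ} (h : α j ≠ 0) (c : k) :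
    monomial α c = X j * monomial (α - Finsupp.single j 1) c := by
  rw [X, monomial_mul, one_mul,
    add_tsub_cancel_of_le (Finsupp.single_le_iff.2 (Nat.one_le_iff_ne_zero.2 h))]

/-- `divX` is not a derivation, but on a product of two terms it can divide whichever factor
contains the variable. Closure under taking terms keeps the factors in the ideals. -/
theorem divX_mul_mem (j : τ) {U₁ U₂ V₁ V₂ : Ideal (MvPolynomial τ k)} (h₁ : ContainsTerms U₁)
    (h₂ : ContainsTerms U₂) (hV₁ : ∀ f ∈ U₁, divX j f ∈ V₁) (hV₂ : ∀ f ∈ U₂, divX j f ∈ V₂) :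
    ∀ f ∈ U₁ * U₂, divX j f ∈ V₁ * U₂ ⊔ U₁ * V₂ := by
  intro f hf
  refine Submodule.mul_induction_on hf (fun f hf g hg => ?_) fun f g hf hg => ?_
  · rw [f.as_sum, g.as_sum, Finset.sum_mul_sum, map_sum]
    refine Ideal.sum_mem _ fun α _ => ?_
    rw [map_sum]
    refine Ideal.sum_mem _ fun β _ => ?_
    have hα := h₁ f hf α
    have hβ := h₂ g hg β
    by_cases hj : α j = 0
    · by_cases hj' : β j = 0
      · rw [monomial_mul, divX_monomial (by simp [hj, hj'])]
        exact zero_mem _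
      · refine Submodule.mem_sup_right ?_
        have := hV₂ _ hβ
        rw [monomial_eq_X_mul hj', divX_X_mul_self] at this
        rw [monomial_eq_X_mul hj', mul_left_comm, divX_X_mul_self]
        exact Ideal.mul_mem_mul hα this
    · refine Submodule.mem_sup_left ?_
      have := hV₁ _ hα
      rw [monomial_eq_X_mul hj, divX_X_mul_self] at this
      rw [monomial_eq_X_mul hj, mul_assoc, divX_X_mul_self]
      exact Ideal.mul_mem_mul this hβ
  · rw [map_add]
    exact add_mem hf hg

theorem pderiv_mul_mem (j : τ) {U₁ U₂ V₁ V₂ : Ideal (MvPolynomial τ k)}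
    (hV₁ : ∀ f ∈ U₁, pderiv j f ∈ V₁) (hV₂ : ∀ f ∈ U₂, pderiv j f ∈ V₂) :
    ∀ f ∈ U₁ * U₂, pderiv j f ∈ V₁ * U₂ ⊔ U₁ * V₂ := by
  intro f hf
  refine Submodule.mul_induction_on hf (fun f hf g hg => ?_) fun f g hf hg => ?_
  · rw [pderiv_mul]
    exact add_mem (Submodule.mem_sup_left (Ideal.mul_mem_mul (hV₁ f hf) hg))
      (Submodule.mem_sup_right (Ideal.mul_mem_mul hf (hV₂ g hg)))
  · rw [map_add]
    exact add_mem hf hg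

variable [Fintype τ] [DecidableEq τ] {sgn : τ → Finset τ → ℤ}

theorem koszulZ_le_of_containsTerms (hs : IsKoszulSign sgn) {U V : Ideal (MvPolynomial τ k)}
    (hU : ContainsTerms U) (hUn : U ≤ idealOfVars τ k) (hV : ∀ j, ∀ f ∈ U, divX j f ∈ V) (a : ℕ) :
    koszulZ sgn X a U ≤ koszulB sgn X a V := by
  refine koszulZ_le_koszulB_of_division hs divX Finset.univ
    (fun j m => by rw [smul_eq_mul, divX_X_mul_self])
    (fun i j m h => by rw [smul_eq_mul, smul_eq_mul, divX_X_mul h]) divX_comm (fun j _ f hf => ?_)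
    (fun j _ => hV j) (fun f hf h => ?_) a
  · rw [smul_eq_mul, MvPolynomial.as_sum (X j * divX j f)]
    refine Ideal.sum_mem _ fun α _ => ?_
    rw [coeff_X_mul_divX]
    split_ifs
    · rw [map_zero]
      exact zero_mem _
    · exact hU f hf α
  · exact eq_zero_of_divX ((mem_pow_idealOfVars_iff' 1 f).1 (by rw [pow_one]; exact hUn hf) 0
      (by simp)) fun j => h j (Finset.mem_univ j)

/-- The differential is homogeneous, so the homogeneous components of a cycle are cycles and Euler's
formula can be applied to each. -/
theorem koszulD_homogeneousComponent (z : Finset τ → MvPolynomial τ k) (n : ℕ) :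
    koszulD sgn (X : τ → MvPolynomial τ k) (fun I => homogeneousComponent n (z I)) =
      fun I => homogeneousComponent (n + 1) (koszulD sgn (X : τ → MvPolynomial τ k) z I) := by
  have hX : ∀ (i : τ) (f : MvPolynomial τ k),
      homogeneousComponent (n + 1) (X i * f) = X i * homogeneousComponent n f := by
    intro i f
    ext α
    rw [coeff_homogeneousComponent, coeff_X_mul', coeff_X_mul', coeff_homogeneousComponent]
    by_cases hi : i ∈ α.support
    · have hle : Finsupp.single i 1 ≤ α :=
        Finsupp.single_le_iff.2 (Nat.one_le_iff_ne_zero.2 (Finsupp.mem_support_iff.1 hi))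
      have hd : (α - Finsupp.single i 1).degree + 1 = α.degree := by
        conv_rhs => rw [← tsub_add_cancel_of_le hle, map_add, Finsupp.degree_single]
      simp only [hi, if_true, ← hd, Nat.add_right_cancel_iff]
    · simp [hi]
  ext1 I
  simp only [koszulD_apply, map_sum, smul_eq_mul]
  refine Finset.sum_congr rfl fun i _ => ?_
  split_ifs
  · simp
  · rw [hX, map_zsmul]

/-- The homotopy `∑ e_j ∧ ∂_j` composes with the differential to multiplication by `n + a` on cycles
of exterior degree `a` with coefficients of degree `n`, by Cartan's and Euler's formulas; this
scalar is invertible unless both are zero. -/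
theorem koszulZ_le_of_charZero [CharZero k] (hs : IsKoszulSign sgn)
    {U V : Ideal (MvPolynomial τ k)} (hU : ∀ f ∈ U, ∀ n, homogeneousComponent n f ∈ U)
    (hUn : U ≤ idealOfVars τ k) (hV : ∀ j, ∀ f ∈ U, pderiv j f ∈ V) (a : ℕ) :
    koszulZ sgn X a U ≤ koszulB sgn X a V := by
  intro z hz
  let y : ℕ → Finset τ → MvPolynomial τ k := fun n I => homogeneousComponent n (z I)
  have hy : ∀ n, koszulD sgn (X : τ → MvPolynomial τ k) (y n) = 0 := fun n => by
    have h0 : koszulD sgn (X : τ → MvPolynomial τ k) z = 0 := hz.2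
    rw [koszulD_homogeneousComponent, h0]
    ext1 I
    simp
  let w : ℕ → Finset τ → MvPolynomial τ k := fun n =>
    (C ((n + a : ℕ) : k)⁻¹ : MvPolynomial τ k) •
      ∑ j, wedge sgn j fun I => (pderiv (R := k) j).toLinearMap.toAddMonoidHom (y n I)
  have hw : ∀ n, w n ∈ koszulK τ (a + 1) V := fun n =>
    Submodule.smul_mem _ _ (Submodule.sum_mem _ fun j _ => wedge_mem_koszulK j
      ⟨fun I => hV j _ (hU _ (hz.1.1 I) n), fun I hI => by simp [y, hz.1.2 I hI]⟩)
  have hdw : ∀ n, koszulD sgn (X : τ → MvPolynomial τ k) (w n) = y n := by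
    intro n
    ext1 I
    rw [map_smul, Pi.smul_apply, koszulD_sum_wedge hs _ (fun i j m => ?_) (hy n)]
    · by_cases hI : I.card = a
      · change C _ • (∑ j, X j * pderiv j (homogeneousComponent n (z I)) + _) = _
        rw [(homogeneousComponent_isHomogeneous n (z I)).sum_X_mul_pderiv, hI, ← add_smul]
        -- For `n = a = 0` the scalar vanishes, but so does the component: elements of `U` have no
        -- constant term.
        by_cases hna : n + a = 0
        · have hn : n = 0 := by omega
          have : homogeneousComponent n (z I) = 0 := by
            rw [hn, homogeneousComponent_zero, (mem_pow_idealOfVars_iff' 1 (z I)).1 (by rw [pow_one]; exact hUn (hz.1.1 I)) 0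
              (by simp), C_0]
          change _ = homogeneousComponent n (z I)
          rw [this, smul_zero, smul_zero]
        · rw [← Nat.cast_smul_eq_nsmul k, smul_eq_C_mul, smul_eq_mul, ← mul_assoc, ← C_mul,
            inv_mul_cancel₀ (Nat.cast_ne_zero.2 hna), C_1, one_mul]
      · simp [y, hz.1.2 I hI]
    · change pderiv j (X i * m) = X i * pderiv j m + _
      rw [pderiv_mul, pderiv_X, add_comm]
      congr 1
      by_cases hij : i = j
      · subst hij
        simp
      · simp [hij]
  let N := Finset.univ.sup fun I => (z I).totalDegree
  refine ⟨∑ n ∈ Finset.range (N + 1), w n, Submodule.sum_mem _ fun n _ => hw n, ?_⟩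
  rw [map_sum]
  ext1 I
  simp only [hdw, Finset.sum_apply]
  conv_rhs => rw [← sum_homogeneousComponent (z I)]
  symm
  refine Finset.sum_subset (Finset.range_mono (Nat.succ_le_succ
    (Finset.le_sup (f := fun I => (z I).totalDegree) (Finset.mem_univ I)))) fun n _ hn => ?_
  exact homogeneousComponent_eq_zero _ _ (by simpa [Nat.lt_succ_iff] using hn)

end PolynomialVanishing

/-! ### The inclusion `𝔫^p J^(t+1) → 𝔫^(p+1) J^t` over `S`, and its extension to all variables -/

section PolynomialPowers

open MvPolynomial

variable {τ k : Type*} [Field k]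

theorem isHomogeneous_idealOfVars :
    (idealOfVars τ k).IsHomogeneous (homogeneousSubmodule τ k) :=
  Ideal.homogeneous_span _ _ (by
    rintro _ ⟨j, rfl⟩
    exact ⟨1, isHomogeneous_X k j⟩)

theorem isHomogeneous_pow {U : Ideal (MvPolynomial τ k)}
    (hU : U.IsHomogeneous (homogeneousSubmodule τ k)) (n : ℕ) :
    (U ^ n).IsHomogeneous (homogeneousSubmodule τ k) := by
  induction n with
  | zero => rw [pow_zero, Ideal.one_eq_top]; exact Ideal.IsHomogeneous.top _
  | succ n ih => exact ih.mul hU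

theorem homogeneousComponent_mem_of_isHomogeneous {U : Ideal (MvPolynomial τ k)}
    (hU : U.IsHomogeneous (homogeneousSubmodule τ k)) {f : MvPolynomial τ k} (hf : f ∈ U) (n : ℕ) :
    homogeneousComponent n f ∈ U := by
  have := hU n hf
  rwa [show ((DirectSum.decompose (homogeneousSubmodule τ k) f n : homogeneousSubmodule τ k n) :
    MvPolynomial τ k) = homogeneousComponent n f from decomposition.decompose'_apply f n] at this

theorem ContainsTerms.pow {U : Ideal (MvPolynomial τ k)} (h : ContainsTerms U) (n : ℕ) :
    ContainsTerms (U ^ n) := by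
  induction n with
  | zero => intro f _ α; simp
  | succ n ih => exact ih.mul h

variable [Fintype τ] [DecidableEq τ] {sgn : τ → Finset τ → ℤ}

/-- In the first two cases the operators `∂_j` or `divX j` map the source into the target, since `J
⊆ 𝔫^2` sends `J` into `𝔫`. In the last two the inclusion factors through `𝔫^(p+2) J^t`, and the
vanishing is known for powers of `𝔫` or for the Koszul ideal `J^t`. -/
theorem koszulZ_pow_mul_pow_le (hs : IsKoszulSign sgn) {J : Ideal (MvPolynomial τ k)}
    (hJ : J.IsHomogeneous (homogeneousSubmodule τ k)) (hJ2 : J ≤ idealOfVars τ k ^ 2) (t : ℕ)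
    (h : CharZero k ∨ IsMonomialIdeal J ∨ t = 0 ∨ IsKoszulIdeal (J ^ t)) (p a : ℕ) :
    koszulZ sgn X a (idealOfVars τ k ^ p * J ^ (t + 1)) ≤
      koszulB sgn X a (idealOfVars τ k ^ (p + 1) * J ^ t) := by
  have hle : idealOfVars τ k ^ p * J ^ (t + 1) ≤ idealOfVars τ k ^ (p + 2) * J ^ t := by
    rw [pow_succ', ← mul_assoc, pow_add]
    exact Ideal.mul_mono_left (Ideal.mul_mono_right hJ2)
  have hn : idealOfVars τ k ^ p * J ^ (t + 1) ≤ idealOfVars τ k :=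
    hle.trans (Ideal.mul_le_left.trans (Ideal.pow_le_self (Nat.succ_ne_zero _)))
  rcases h with h | h | rfl | h
  · refine koszulZ_le_of_charZero hs (fun f hf n => homogeneousComponent_mem_of_isHomogeneous
      ((isHomogeneous_pow isHomogeneous_idealOfVars p).mul (isHomogeneous_pow hJ (t + 1))) hf n) hn (fun j => ?_) a
    exact map_pow_mul_pow_mem (pderiv (R := k) j).toLinearMap.toAddMonoidHom (fun _ => True)
      (fun _ _ _ _ => trivial) (fun U₁ U₂ V₁ V₂ _ _ h₁ h₂ => pderiv_mul_mem j h₁ h₂)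
      trivial trivial hJ2 p t
  · refine koszulZ_le_of_containsTerms hs ((containsTerms_idealOfVars.pow p).mul
      (h.containsTerms.pow (t + 1))) hn (fun j => ?_) a
    exact map_pow_mul_pow_mem (divX j) ContainsTerms (fun _ _ h₁ h₂ => h₁.mul h₂)
      (fun U₁ U₂ V₁ V₂ hU₁ hU₂ h₁ h₂ => divX_mul_mem j hU₁ hU₂ h₁ h₂)
      containsTerms_idealOfVars h.containsTerms hJ2 p t
  · rw [pow_zero, mul_one] at hle ⊢
    exact (koszulZ_mono hle).trans (koszulZ_le_koszulB_pow_idealOfVars hs (p + 1) a)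
  · exact (koszulZ_mono hle).trans (h.koszulZ_le hs (p + 1) a)

variable {σ : Type*} [Fintype σ] [DecidableEq σ]

/-- Vanishing on homology gives a null-homotopy that is only `k`-linear. That is enough, because the
complex over `S[σ]` is cut into fibres by monomials in `σ`, not by `S`-linear choices. -/
theorem koszulZ_sumVars_le_of_koszulZ_le {sgnσ : σ → Finset σ → ℤ} (hs : IsKoszulSign sgn)
    {U V : Ideal (MvPolynomial τ k)} (hUV : U ≤ V)
    (h : ∀ a, koszulZ sgn X a U ≤ koszulB sgn X a V) (q a : ℕ) :
    koszulZ (sumSign sgnσ sgn) (sumVars σ τ k) a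
        (idealOfVars σ (MvPolynomial τ k) ^ q * extendC σ U) ≤
      koszulB (sumSign sgnσ sgn) (sumVars σ τ k) a
        (idealOfVars σ (MvPolynomial τ k) ^ q * extendC σ V) := by
  let chains (W : Ideal (MvPolynomial τ k)) : Submodule k (Finset τ → MvPolynomial τ k) :=
    Submodule.pi Set.univ fun _ => W.restrictScalars k
  have hchains : ∀ W f, f ∈ chains W ↔ ∀ L, f L ∈ W := fun W f => by simp [chains]
  obtain ⟨η, hη⟩ := exists_linear_homotopy ((koszulD sgn X).restrictScalars k)
    (fun f => koszulD_koszulD X hs f) (chains U) (chains V)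
    (fun c hc => (hchains _ _).2 (koszulD_apply_mem sgn X ((hchains _ _).1 hc)))
    (fun c hc => (hchains _ _).2 fun L => hUV ((hchains _ _).1 hc L))
    (fun z hz hdz => by
      obtain ⟨w, hw, hwz⟩ := exists_koszulD_eq_of_koszulZ_le h ((hchains _ _).1 hz) hdz
      exact ⟨w, (hchains _ _).2 hw, hwz⟩)
  exact koszulZ_le_koszulB_of_homotopy X η.toAddMonoidHom (fun c hc =>
    ⟨(hchains _ _).1 (hη c ((hchains _ _).2 hc)).1, (hη c ((hchains _ _).2 hc)).2⟩) q a

end PolynomialPowers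

/-! ### Transport along ring isomorphisms -/

section Transport

variable {ι : Type*} [DecidableEq ι] [Fintype ι] {sgn : ι → Finset ι → ℤ}
  {A B : Type*} [CommRing A] [CommRing B] (φ : A ≃+* B) {x : ι → A} {y : ι → B}

theorem koszulD_ringEquiv (hxy : ∀ i, φ (x i) = y i) (f : Finset ι → A) :
    koszulD sgn y (fun I => φ (f I)) = fun I => φ (koszulD sgn x f I) := by
  ext1 I
  rw [koszulD_apply, koszulD_apply, map_sum]
  refine Finset.sum_congr rfl fun i _ => ?_
  split_ifs
  · rw [map_zero]
  · rw [smul_eq_mul, smul_eq_mul, map_mul, hxy, map_zsmul]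

theorem koszulZ_le_koszulB_of_ringEquiv (hxy : ∀ i, φ (x i) = y i) {U V : Ideal A} {U' V' : Ideal B}
    (hU : U.map φ = U') (hV : V.map φ = V') (a : ℕ)
    (h : koszulZ sgn y a U' ≤ koszulB sgn y a V') :
    koszulZ sgn x a U ≤ koszulB sgn x a V := by
  intro z hz
  have hz0 : koszulD sgn x z = 0 := hz.2
  obtain ⟨w, hw, hwz⟩ := h (x := fun I => φ (z I)) ⟨⟨fun I => hU ▸ Ideal.mem_map_of_mem _ (hz.1.1 I),
    fun I hI => by simp [hz.1.2 I hI]⟩, by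
      change koszulD sgn y _ = 0
      rw [koszulD_ringEquiv φ hxy, hz0]
      ext1 I
      exact map_zero φ⟩
  refine ⟨fun I => φ.symm (w I), ⟨fun I => ?_, fun I hI => by simp [hw.2 I hI]⟩, ?_⟩
  · have := hw.1 I
    rw [← hV, Ideal.mem_map_of_equiv] at this
    obtain ⟨v, hv, e⟩ := this
    dsimp only
    rw [← e]
    exact (φ.symm_apply_apply v).symm ▸ hv
  · rw [koszulD_ringEquiv φ.symm (x := y) (y := x) fun i => by rw [← hxy, φ.symm_apply_apply], hwz]
    ext1 I
    exact φ.symm_apply_apply _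

end Transport

/-! ### Powers of sums of ideals -/

section IdealPowers

variable {T : Type*} [CommRing T] {I J 𝔪 𝔫 : Ideal T}

/-- The index `i = 0`, absent from the sum, is covered by `𝔮^s ≤ H^s`. -/
theorem mul_pow_mul_pow_le_add_sum (𝔮 H : Ideal T) (hH : 𝔮 ≤ H) {s t i : ℕ} (hi : i ≤ t) :
    𝔮 ^ (s - i) * J ^ i ≤ H ^ s + ∑ i ∈ Finset.Icc 1 t, 𝔮 ^ (s - i) * J ^ i := by
  rcases Nat.eq_zero_or_pos i with rfl | h
  · rw [pow_zero, mul_one, Nat.sub_zero]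
    exact (Ideal.pow_right_mono hH s).trans le_sup_left
  · rw [Submodule.add_eq_sup, Ideal.sum_eq_sup]
    exact le_trans (Finset.le_sup (f := fun i => 𝔮 ^ (s - i) * J ^ i)
      (Finset.mem_Icc.2 ⟨h, hi⟩)) le_sup_right

theorem add_sum_le {𝔮 H K : Ideal T} {s t : ℕ} (h0 : H ^ s ≤ K)
    (h : ∀ i, 1 ≤ i → i ≤ t → 𝔮 ^ (s - i) * J ^ i ≤ K) :
    H ^ s + ∑ i ∈ Finset.Icc 1 t, 𝔮 ^ (s - i) * J ^ i ≤ K := by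
  rw [Submodule.add_eq_sup, Ideal.sum_eq_sup]
  exact sup_le h0 (Finset.sup_le fun i hi => h i (Finset.mem_Icc.1 hi).1 (Finset.mem_Icc.1 hi).2)

theorem fiberProduct_pow_eq (hI : I ≤ 𝔪 ^ 2) (hJ : J ≤ 𝔫 ^ 2) (s : ℕ) :
    (I + J + 𝔪 * 𝔫) ^ s =
      (I + 𝔪 * 𝔫) ^ s + ∑ i ∈ Finset.Icc 1 s, (𝔪 * 𝔫) ^ (s - i) * J ^ i := by
  have hIJ : I * J ≤ (𝔪 * 𝔫) ^ 2 := by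
    rw [mul_pow]
    exact Ideal.mul_mono hI hJ
  have hIF : I + 𝔪 * 𝔫 ≤ I + J + 𝔪 * 𝔫 := by
    simp only [Submodule.add_eq_sup]
    exact sup_le_sup_right le_sup_left _
  refine le_antisymm ?_ (add_sum_le (Ideal.pow_right_mono hIF s) fun i _ hi => ?_)
  · have hJH : ∀ s, J * (I + 𝔪 * 𝔫) ^ s ≤ (𝔪 * 𝔫) ^ s * J + (I + 𝔪 * 𝔫) ^ (s + 1) := by
      intro s
      induction s with
      | zero => simp only [pow_zero, mul_one, one_mul, Submodule.add_eq_sup]; exact le_sup_left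
      | succ s ih =>
        rw [pow_succ, ← mul_assoc]
        refine (Ideal.mul_mono_left ih).trans ?_
        rw [add_mul, mul_add, ← pow_succ (I + 𝔪 * 𝔫) (s + 1)]
        simp only [Submodule.add_eq_sup]
        refine sup_le (sup_le (le_trans ?_ le_sup_right) (le_trans ?_ le_sup_left)) le_sup_right
        · calc (𝔪 * 𝔫) ^ s * J * I = (𝔪 * 𝔫) ^ s * (I * J) := by ring
            _ ≤ (𝔪 * 𝔫) ^ s * (𝔪 * 𝔫) ^ 2 := Ideal.mul_mono_right hIJ
            _ = (𝔪 * 𝔫) ^ (s + 1 + 1) := by ring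
            _ ≤ (I ⊔ 𝔪 * 𝔫) ^ (s + 1 + 1) := Ideal.pow_right_mono le_sup_right _
        · exact le_of_eq (by ring)
    induction s with
    | zero => simp
    | succ s ih =>
      set E := (I + 𝔪 * 𝔫) ^ (s + 1) +
        ∑ i ∈ Finset.Icc 1 (s + 1), (𝔪 * 𝔫) ^ (s + 1 - i) * J ^ i with hE
      have hterm : ∀ i ≤ s + 1, (𝔪 * 𝔫) ^ (s + 1 - i) * J ^ i ≤ E := fun i hi =>
        mul_pow_mul_pow_le_add_sum _ _ (by rw [Submodule.add_eq_sup]; exact le_sup_right) hi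
      have hHE : (I + 𝔪 * 𝔫) ^ (s + 1) ≤ E := by
        rw [hE, Submodule.add_eq_sup]
        exact le_sup_left
      rw [pow_succ]
      refine (Ideal.mul_mono_left ih).trans ?_
      rw [mul_comm, show I + J + 𝔪 * 𝔫 = (I + 𝔪 * 𝔫) + J by ring, add_mul]
      have hH : ∀ X : Ideal T, X * ((I + 𝔪 * 𝔫) ^ s +
          ∑ i ∈ Finset.Icc 1 s, (𝔪 * 𝔫) ^ (s - i) * J ^ i) =
          X * (I + 𝔪 * 𝔫) ^ s ⊔ (Finset.Icc 1 s).sup fun i => X * ((𝔪 * 𝔫) ^ (s - i) * J ^ i) := by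
        intro X
        rw [mul_add, Finset.mul_sum, Submodule.add_eq_sup, Ideal.sum_eq_sup]
      rw [hH, hH, Submodule.add_eq_sup]
      refine sup_le (sup_le ?_ (Finset.sup_le fun i hi => ?_))
        (sup_le ?_ (Finset.sup_le fun i hi => ?_))
      · rw [← pow_succ']
        exact hHE
      · obtain ⟨hi1, his⟩ := Finset.mem_Icc.1 hi
        obtain ⟨j, rfl⟩ := Nat.exists_eq_add_of_le' hi1
        rw [add_mul, Submodule.add_eq_sup]
        refine sup_le ?_ ?_
        -- Multiplying by `I` trades one factor `J` for two factors `𝔪𝔫`, so the term of index `j +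
        -- 1` falls into the term of index `j`; for `j = 0` this is part of `H^(s+1)`.
        · calc I * ((𝔪 * 𝔫) ^ (s - (j + 1)) * J ^ (j + 1))
              = (𝔪 * 𝔫) ^ (s - (j + 1)) * (I * J) * J ^ j := by ring
            _ ≤ (𝔪 * 𝔫) ^ (s - (j + 1)) * (𝔪 * 𝔫) ^ 2 * J ^ j :=
                Ideal.mul_mono_left (Ideal.mul_mono_right hIJ)
            _ = (𝔪 * 𝔫) ^ (s + 1 - j) * J ^ j := by
                rw [← pow_add, show s - (j + 1) + 2 = s + 1 - j by omega]
            _ ≤ E := hterm j (by omega)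
        · rw [← mul_assoc, ← pow_succ', show s - (j + 1) + 1 = s + 1 - (j + 1) by omega]
          exact hterm _ (by omega)
      · refine (hJH s).trans ?_
        rw [Submodule.add_eq_sup]
        refine sup_le ?_ hHE
        have := hterm 1 (by omega)
        rwa [pow_one, Nat.add_sub_cancel] at this
      · obtain ⟨hi1, his⟩ := Finset.mem_Icc.1 hi
        rw [mul_left_comm, ← pow_succ', show s - i = s + 1 - (i + 1) by omega]
        exact hterm _ (by omega)
  · have h1 : 𝔪 * 𝔫 ≤ I + J + 𝔪 * 𝔫 := by simp only [Submodule.add_eq_sup]; exact le_sup_right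
    have h2 : J ≤ I + J + 𝔪 * 𝔫 := by
      simp only [Submodule.add_eq_sup]
      exact le_trans le_sup_right le_sup_left
    calc (𝔪 * 𝔫) ^ (s - i) * J ^ i
        ≤ (I + J + 𝔪 * 𝔫) ^ (s - i) * (I + J + 𝔪 * 𝔫) ^ i :=
          Ideal.mul_mono (Ideal.pow_right_mono h1 _) (Ideal.pow_right_mono h2 _)
      _ = (I + J + 𝔪 * 𝔫) ^ s := by rw [← pow_add, Nat.sub_add_cancel hi]

end IdealPowers

/-! ### The tensor product of two polynomial rings -/

section TensorProduct

open MvPolynomial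

variable (k σ τ : Type*) [Field k]

/-- The isomorphism `k[σ] ⊗ k[τ] ≃ k[τ][σ]`. -/
noncomputable def tensorEquiv :
    MvPolynomial σ k ⊗[k] MvPolynomial τ k ≃+* MvPolynomial σ (MvPolynomial τ k) :=
  (Algebra.TensorProduct.comm k (MvPolynomial σ k) (MvPolynomial τ k)).toRingEquiv.trans
    (algebraTensorAlgEquiv k (MvPolynomial τ k)).toRingEquiv

/-- The variables of `k[σ] ⊗ k[τ]`. -/
noncomputable def tensorVars : σ ⊕ τ → MvPolynomial σ k ⊗[k] MvPolynomial τ k :=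
  Sum.elim (fun i => X i ⊗ₜ 1) fun j => 1 ⊗ₜ X j

variable {k σ τ}

theorem tensorEquiv_tmul (f : MvPolynomial σ k) (g : MvPolynomial τ k) :
    tensorEquiv k σ τ (f ⊗ₜ g) = C g * map (algebraMap k (MvPolynomial τ k)) f := by
  rw [← smul_eq_C_mul]
  exact algebraTensorAlgEquiv_tmul k (MvPolynomial τ k) g f

theorem tensorEquiv_tensorVars (i : σ ⊕ τ) :
    tensorEquiv k σ τ (tensorVars k σ τ i) = sumVars σ τ k i := by
  rcases i with i | j
  · simp [tensorVars, sumVars, tensorEquiv_tmul]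
  · simp [tensorVars, sumVars, tensorEquiv_tmul]

theorem map_extRight (L : Ideal (MvPolynomial τ k)) :
    (extRight σ L).map (tensorEquiv k σ τ) = extendC σ L := by
  change Ideal.map (tensorEquiv k σ τ).toRingHom (Ideal.map (AlgHom.toRingHom _) L) = _
  rw [Ideal.map_map]
  congr 1
  refine RingHom.ext fun g => ?_
  change tensorEquiv k σ τ (1 ⊗ₜ g) = C g
  rw [tensorEquiv_tmul, map_one, mul_one]

theorem map_maxLeft :
    (maxLeft k σ τ).map (tensorEquiv k σ τ) = idealOfVars σ (MvPolynomial τ k) := by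
  change Ideal.map (tensorEquiv k σ τ).toRingHom (Ideal.map (AlgHom.toRingHom _)
    (Ideal.span (Set.range X))) = Ideal.span _
  rw [Ideal.map_map, Ideal.map_span, ← Set.range_comp]
  congr 2
  ext1 i
  exact tensorEquiv_tensorVars (Sum.inl i)

theorem map_maxLeft_pow_mul (q : ℕ) (L : Ideal (MvPolynomial τ k)) :
    (maxLeft k σ τ ^ q * extRight σ L).map (tensorEquiv k σ τ) =
      idealOfVars σ (MvPolynomial τ k) ^ q * extendC σ L := by
  rw [Ideal.map_mul, Ideal.map_pow, map_maxLeft, map_extRight]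

theorem maxLeft_add_maxRight :
    maxLeft k σ τ + maxRight k σ τ = Ideal.span (Set.range (tensorVars k σ τ)) := by
  rw [maxLeft, maxRight, extLeft, extRight, Ideal.map_span, Ideal.map_span, ← Set.range_comp,
    ← Set.range_comp, tensorVars, Set.Sum.elim_range, Ideal.span_union]
  rfl

theorem extRight_mul (L M : Ideal (MvPolynomial τ k)) :
    extRight σ (L * M) = extRight σ L * extRight σ M := Ideal.map_mul _ _ _

theorem extRight_pow (L : Ideal (MvPolynomial τ k)) (n : ℕ) :
    extRight σ (L ^ n) = extRight σ L ^ n := Ideal.map_pow _ _ _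

theorem extRight_mono {L M : Ideal (MvPolynomial τ k)} (h : L ≤ M) :
    extRight σ L ≤ extRight σ M := Ideal.map_mono h

theorem extLeft_le_maxLeft_sq {I : Ideal (MvPolynomial σ k)} (hI : I ≤ idealOfVars σ k ^ 2) :
    extLeft τ I ≤ maxLeft k σ τ ^ 2 := by
  rw [maxLeft, extLeft, extLeft, ← Ideal.map_pow]
  exact Ideal.map_mono hI

theorem extRight_le_maxRight_sq {J : Ideal (MvPolynomial τ k)} (hJ : J ≤ idealOfVars τ k ^ 2) :
    extRight σ J ≤ maxRight k σ τ ^ 2 := by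
  rw [maxRight, ← extRight_pow]
  exact extRight_mono hJ

/-- Transported to `S[σ]`, this is the independence of the degree condition in `σ` from the
condition on coefficients in `S`. -/
theorem maxLeft_pow_inf_extRight (q : ℕ) (L : Ideal (MvPolynomial τ k)) :
    maxLeft k σ τ ^ q ⊓ extRight σ L = maxLeft k σ τ ^ q * extRight σ L := by
  refine le_antisymm (fun f hf => ?_) Ideal.mul_le_inf
  have h : tensorEquiv k σ τ f ∈ idealOfVars σ (MvPolynomial τ k) ^ q ⊓ extendC σ L := by
    rw [← map_maxLeft, ← Ideal.map_pow, ← map_extRight]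
    exact ⟨Ideal.mem_map_of_mem _ hf.1, Ideal.mem_map_of_mem _ hf.2⟩
  rw [pow_idealOfVars_inf_map_C, ← map_maxLeft_pow_mul, Ideal.mem_map_of_equiv] at h
  obtain ⟨g, hg, e⟩ := h
  rwa [← (tensorEquiv k σ τ).injective e]

/-- Evaluation at the origin kills all variables but not the unit. -/
theorem maxLeft_add_maxRight_ne_top : maxLeft k σ τ + maxRight k σ τ ≠ ⊤ := by
  intro h
  have h1 : (maxLeft k σ τ + maxRight k σ τ).map
      ((constantCoeff.comp constantCoeff).comp (tensorEquiv k σ τ).toRingHom) ≤ ⊥ := by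
    rw [maxLeft_add_maxRight, Ideal.map_span, Ideal.span_le]
    rintro _ ⟨_, ⟨i, rfl⟩, rfl⟩
    have : tensorEquiv k σ τ (tensorVars k σ τ i) = _ := tensorEquiv_tensorVars i
    change constantCoeff (constantCoeff (tensorEquiv k σ τ (tensorVars k σ τ i))) = 0
    rw [this]
    rcases i with i | j <;> simp [sumVars]
  rw [h, Ideal.map_top, top_le_iff] at h1
  exact bot_ne_top h1

theorem extRight_ne_bot {J : Ideal (MvPolynomial τ k)} (hJ : J ≠ ⊥) : extRight σ J ≠ ⊥ := by
  intro h
  refine hJ (eq_bot_iff.2 fun f hf => ?_)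
  have h1 : (C f : MvPolynomial σ (MvPolynomial τ k)) ∈ extendC σ J := Ideal.mem_map_of_mem _ hf
  rw [← map_extRight, h, Ideal.map_bot, Ideal.mem_bot, C_eq_zero] at h1
  exact h1

theorem maxLeft_ne_bot [Nonempty σ] : maxLeft k σ τ ≠ ⊥ := by
  intro h
  obtain ⟨i⟩ := ‹Nonempty σ›
  have h1 : (X i : MvPolynomial σ (MvPolynomial τ k)) ∈ idealOfVars σ (MvPolynomial τ k) :=
    Ideal.subset_span ⟨i, rfl⟩
  rw [← map_maxLeft, h, Ideal.map_bot, Ideal.mem_bot] at h1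
  exact X_ne_zero i h1

theorem idealOfVars_ne_bot [Nonempty τ] : idealOfVars τ k ≠ ⊥ := by
  intro h
  obtain ⟨i⟩ := ‹Nonempty τ›
  have h1 : (X i : MvPolynomial τ k) ∈ idealOfVars τ k := Ideal.subset_span ⟨i, rfl⟩
  rw [h, Ideal.mem_bot] at h1
  exact X_ne_zero i h1

instance isDomain_tensorProduct : IsDomain (MvPolynomial σ k ⊗[k] MvPolynomial τ k) :=
  (tensorEquiv k σ τ).toMulEquiv.isDomain _

end TensorProduct

/-- The index types carry no order; a well-ordering supplies one. -/
theorem exists_isKoszulSign (ι : Type*) [DecidableEq ι] :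
    ∃ sgn : ι → Finset ι → ℤ, IsKoszulSign sgn := by
  let : LinearOrder ι := IsWellOrder.linearOrder WellOrderingRel
  exact ⟨orderSign, by convert isKoszulSign_orderSign (ι := ι)⟩

/-! ### The filtration of the powers of the fiber product -/

section Filtration

variable {T : Type*} [CommRing T] {I J 𝔪 𝔫 : Ideal T}

theorem mul_pow_mul_eq (p : ℕ) (L : Ideal T) : (𝔪 * 𝔫) ^ p * L = 𝔪 ^ p * (𝔫 ^ p * L) := by
  rw [mul_pow, mul_assoc]

theorem pow_succ_mul_le (L : Ideal T) (p : ℕ) : 𝔪 ^ (p + 1) * L ≤ 𝔪 ^ p * L :=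
  Ideal.mul_mono_left (Ideal.pow_le_pow_right (Nat.le_succ p))

theorem pow_mul_pow_succ_le (hJ : J ≤ 𝔫 ^ 2) (p t : ℕ) :
    𝔫 ^ p * J ^ (t + 1) ≤ 𝔫 ^ (p + 1) * J ^ t := by
  rw [pow_succ', ← mul_assoc, pow_succ 𝔫]
  exact Ideal.mul_mono_left (Ideal.mul_mono_right (hJ.trans (Ideal.pow_le_self two_ne_zero)))

theorem add_mul_le_left (hI : I ≤ 𝔪 ^ 2) : I + 𝔪 * 𝔫 ≤ 𝔪 := by
  rw [Submodule.add_eq_sup]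
  exact sup_le (hI.trans (Ideal.pow_le_self two_ne_zero)) Ideal.mul_le_left

theorem add_sum_le_pow (hI : I ≤ 𝔪 ^ 2) {s t : ℕ} :
    (I + 𝔪 * 𝔫) ^ s + ∑ i ∈ Finset.Icc 1 t, (𝔪 * 𝔫) ^ (s - i) * J ^ i ≤ 𝔪 ^ (s - t) :=
  add_sum_le
    ((Ideal.pow_right_mono (add_mul_le_left hI) s).trans (Ideal.pow_le_pow_right (Nat.sub_le s t)))
    fun _ _ hi => Ideal.mul_le_left.trans ((Ideal.pow_right_mono Ideal.mul_le_left _).trans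
      (Ideal.pow_le_pow_right (Nat.sub_le_sub_left hi s)))

theorem add_sum_le_add (hI : I ≤ 𝔪 ^ 2) (hJ : J ≤ 𝔫 ^ 2) {s t : ℕ} (hs : s ≠ 0) :
    (I + 𝔪 * 𝔫) ^ s + ∑ i ∈ Finset.Icc 1 t, (𝔪 * 𝔫) ^ (s - i) * J ^ i ≤ 𝔪 + 𝔫 := by
  rw [Submodule.add_eq_sup 𝔪]
  exact add_sum_le
    (((Ideal.pow_right_mono (add_mul_le_left hI) s).trans (Ideal.pow_le_self hs)).trans le_sup_left)
    fun _ hi _ => ((Ideal.mul_le_right.trans (Ideal.pow_le_self (Nat.one_le_iff_ne_zero.1 hi))).trans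
      (hJ.trans (Ideal.pow_le_self two_ne_zero))).trans le_sup_right

theorem mul_pow_mul_pow_ne_bot [IsDomain T] (hm : 𝔪 ≠ ⊥) (hn : 𝔫 ≠ ⊥) (hJ : J ≠ ⊥) (p t : ℕ) :
    (𝔪 * 𝔫) ^ p * J ^ t ≠ ⊥ :=
  mul_ne_zero (pow_ne_zero _ (mul_ne_zero hm hn)) (pow_ne_zero _ hJ)

end Filtration

/-! ### Intersections and Betti splittings for the ideals `G_t` -/

section FiberProduct

open MvPolynomial

variable {k σ τ : Type*} [Field k] {I : Ideal (MvPolynomial σ k)} {J : Ideal (MvPolynomial τ k)}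

theorem pow_mul_extRight_pow (p t : ℕ) :
    maxRight k σ τ ^ p * extRight σ J ^ t = extRight σ (idealOfVars τ k ^ p * J ^ t) := by
  rw [extRight_mul, extRight_pow, extRight_pow]
  rfl

theorem mul_pow_mul_extRight_pow (p t : ℕ) :
    (maxLeft k σ τ * maxRight k σ τ) ^ p * extRight σ J ^ t =
      maxLeft k σ τ ^ p * extRight σ (idealOfVars τ k ^ p * J ^ t) :=
  (mul_pow_mul_eq p _).trans (congrArg _ (pow_mul_extRight_pow p t))

theorem mul_pow_mul_extRight_pow_le_idealG {s t i : ℕ} (hi : i ≤ t) :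
    (maxLeft k σ τ * maxRight k σ τ) ^ (s - i) * extRight σ J ^ i ≤ idealG I J s t :=
  mul_pow_mul_pow_le_add_sum _ _ (by rw [idealH, Submodule.add_eq_sup]; exact le_sup_right) hi

theorem idealG_succ (s t : ℕ) :
    idealG I J s (t + 1) = idealG I J s t +
      (maxLeft k σ τ * maxRight k σ τ) ^ (s - (t + 1)) * extRight σ J ^ (t + 1) := by
  rw [idealG, Finset.sum_Icc_succ_top (Nat.le_add_left 1 t), ← add_assoc]
  rfl

theorem maxLeft_pow_mul_extRight_le_idealG {s t p : ℕ}
    (h : p + (t + 1) = s) :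
    maxLeft k σ τ ^ (p + 1) * extRight σ (idealOfVars τ k ^ (p + 1) * J ^ t) ≤ idealG I J s t := by
  have := mul_pow_mul_extRight_pow_le_idealG (I := I) (J := J) (s := s) (le_refl t)
  rwa [mul_pow_mul_extRight_pow, show s - t = p + 1 by omega] at this

/-- The upper bound uses only that `G_t` lies in `𝔪^(s-t) = 𝔪^(p+1)` and that the second ideal lies
in the extension of `𝔫^p J^(t+1)`. For the lower bound, `J ⊆ 𝔫^2` exchanges one `J` for a factor
`𝔫`, landing in the last term of `G_t`. -/
theorem idealG_inf (hI : I ≤ idealOfVars σ k ^ 2) (hJ : J ≤ idealOfVars τ k ^ 2) {s t p : ℕ}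
    (h : p + (t + 1) = s) :
    idealG I J s t ⊓ ((maxLeft k σ τ * maxRight k σ τ) ^ p * extRight σ J ^ (t + 1)) =
      maxLeft k σ τ ^ (p + 1) * extRight σ (idealOfVars τ k ^ p * J ^ (t + 1)) := by
  rw [mul_pow_mul_extRight_pow]
  refine le_antisymm ?_ (le_inf ?_ ?_)
  · rw [← maxLeft_pow_inf_extRight (p + 1)]
    have := add_sum_le_pow (I := extLeft τ I) (𝔪 := maxLeft k σ τ) (𝔫 := maxRight k σ τ) (J := extRight σ J) (s := s) (t := t)
      (extLeft_le_maxLeft_sq hI)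
    rw [show s - t = p + 1 by omega] at this
    exact inf_le_inf this Ideal.mul_le_right
  · exact (Ideal.mul_mono_right (extRight_mono (pow_mul_pow_succ_le hJ p t))).trans
      (maxLeft_pow_mul_extRight_le_idealG h)
  · exact pow_succ_mul_le _ p

/-- On the side of `G_t`, the intersection passes through `𝔪^(p+1) 𝔫^(p+1) J^t` and the vanishing
comes from the variables of `S`; on the other side, lowering `𝔪^(p+1)` to `𝔪^p` suffices and the
vanishing comes from those of `R`. -/
theorem bettiNumbersSplit_idealG [Finite σ] [Finite τ]
    (hJh : J.IsHomogeneous (homogeneousSubmodule τ k))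
    (hI : I ≤ idealOfVars σ k ^ 2) (hJ : J ≤ idealOfVars τ k ^ 2) {s t p : ℕ}
    (h : p + (t + 1) = s)
    (hc : CharZero k ∨ IsMonomialIdeal J ∨ t = 0 ∨ IsKoszulIdeal (J ^ t)) :
    BettiNumbersSplit k (maxLeft k σ τ + maxRight k σ τ) (idealG I J s (t + 1)) (idealG I J s t)
      ((maxLeft k σ τ * maxRight k σ τ) ^ p * extRight σ J ^ (t + 1)) := by
  classical
  have := Fintype.ofFinite σ
  have := Fintype.ofFinite τ
  obtain ⟨sgnσ, hσ⟩ := exists_isKoszulSign σ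
  obtain ⟨sgnτ, hτ⟩ := exists_isKoszulSign τ
  have hs := isKoszulSign_sumSign hσ hτ
  rw [idealG_succ, show s - (t + 1) = p by omega, maxLeft_add_maxRight]
  refine bettiNumbersSplit_of_koszul k hs (fun a => ?_) _ _ (fun a => ?_) fun a => ?_
  · exact koszulZ_le_koszulB_of_ringEquiv (tensorEquiv k σ τ) tensorEquiv_tensorVars
      (Ideal.map_top _) (Ideal.map_top _) _ (koszulAcyclic_sumVars hs a)
  · rw [idealG_inf hI hJ h]
    refine le_trans ?_ (koszulB_mono (maxLeft_pow_mul_extRight_le_idealG h))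
    exact koszulZ_le_koszulB_of_ringEquiv (tensorEquiv k σ τ) tensorEquiv_tensorVars
      (map_maxLeft_pow_mul _ _) (map_maxLeft_pow_mul _ _) _
      (koszulZ_sumVars_le_of_koszulZ_le hτ (pow_mul_pow_succ_le hJ p t)
        (koszulZ_pow_mul_pow_le hτ hJh hJ t hc p) (p + 1) a)
  · rw [idealG_inf hI hJ h, mul_pow_mul_extRight_pow]
    exact koszulZ_le_koszulB_of_ringEquiv (tensorEquiv k σ τ) tensorEquiv_tensorVars
      (map_maxLeft_pow_mul _ _) (map_maxLeft_pow_mul _ _) _ (koszulZ_le_koszulB_sumVars hs _ p a)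

theorem mul_pow_mul_extRight_pow_ne_bot [Nonempty σ] [Nonempty τ] (hJ : J ≠ ⊥) (p t : ℕ) :
    (maxLeft k σ τ * maxRight k σ τ) ^ p * extRight σ J ^ t ≠ ⊥ :=
  mul_pow_mul_pow_ne_bot maxLeft_ne_bot (extRight_ne_bot idealOfVars_ne_bot) (extRight_ne_bot hJ) p t

theorem idealG_ne_bot [Nonempty σ] [Nonempty τ] (hJ : J ≠ ⊥) (s t : ℕ) :
    idealG I J s t ≠ ⊥ :=
  ne_bot_of_le_ne_bot (mul_pow_mul_extRight_pow_ne_bot hJ (s - t) t)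
    (mul_pow_mul_extRight_pow_le_idealG le_rfl)

theorem idealG_ne_top (hI : I ≤ idealOfVars σ k ^ 2) (hJ : J ≤ idealOfVars τ k ^ 2) {s : ℕ}
    (hs : s ≠ 0) (t : ℕ) : idealG I J s t ≠ ⊤ := by
  have := add_sum_le_add (I := extLeft τ I) (J := extRight σ J) (𝔪 := maxLeft k σ τ)
    (𝔫 := maxRight k σ τ) (s := s) (t := t) (extLeft_le_maxLeft_sq hI)
    (extRight_le_maxRight_sq hJ) hs
  exact ne_top_of_le_ne_top maxLeft_add_maxRight_ne_top this

theorem isBettiSplitting_idealG [Finite σ] [Finite τ] [Nonempty σ] [Nonempty τ]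
    (hJh : J.IsHomogeneous (homogeneousSubmodule τ k))
    (hI : I ≤ idealOfVars σ k ^ 2) (hJ : J ≤ idealOfVars τ k ^ 2) {s t p : ℕ}
    (h : p + (t + 1) = s)
    (hc : CharZero k ∨ IsMonomialIdeal J ∨ t = 0 ∨ IsKoszulIdeal (J ^ t)) (hJ0 : J ≠ ⊥) :
    IsBettiSplitting k (maxLeft k σ τ + maxRight k σ τ) (idealG I J s (t + 1)) (idealG I J s t)
      ((maxLeft k σ τ * maxRight k σ τ) ^ p * extRight σ J ^ (t + 1)) := by
  have hp : s - (t + 1) = p := by omega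
  have htop := idealG_ne_top hI hJ (show s ≠ 0 by omega) (t + 1)
  refine ⟨⟨idealG_ne_bot hJ0 _ _, idealG_ne_bot hJ0 _ _, mul_pow_mul_extRight_pow_ne_bot hJ0 _ _⟩,
    ⟨htop, idealG_ne_top hI hJ (by omega) _, ne_top_of_le_ne_top htop ?_⟩, ?_,
    bettiNumbersSplit_idealG hJh hI hJ h hc⟩
  · rw [← hp]
    exact mul_pow_mul_extRight_pow_le_idealG le_rfl
  · rw [idealG_succ, hp]

end FiberProduct

end FiberPowers

theorem mainTheorem7 {k σ τ : Type*} [Field k] [Finite σ] [Nonempty σ] [Finite τ] [Nonempty τ]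
    (I : Ideal (MvPolynomial σ k)) (J : Ideal (MvPolynomial τ k))
    (hI : I.IsHomogeneous (MvPolynomial.homogeneousSubmodule σ k))
    (hJ : J.IsHomogeneous (MvPolynomial.homogeneousSubmodule τ k))
    (hI2 : I ≤ MvPolynomial.idealOfVars σ k ^ 2)
    (hJ2 : J ≤ MvPolynomial.idealOfVars τ k ^ 2)
    (s : ℕ) (hs : 1 ≤ s) :
    let 𝔪 := FiberPowers.maxLeft k σ τ
    let 𝔫 := FiberPowers.maxRight k σ τ
    let J' := FiberPowers.extRight σ J
    let G := FiberPowers.idealG I J s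
    FiberPowers.fiberProduct I J ^ s =
        FiberPowers.idealH τ I ^ s + ∑ i ∈ Finset.Icc 1 s, (𝔪 * 𝔫) ^ (s - i) * J' ^ i ∧
    (∀ t, 1 ≤ t → t ≤ s →
      G (t - 1) ⊓ ((𝔪 * 𝔫) ^ (s - t) * J' ^ t) = 𝔪 ^ (s - t + 1) * 𝔫 ^ (s - t) * J' ^ t) ∧
    ((CharZero k ∨ FiberPowers.IsMonomialIdeal J ∨
        ∀ t, 1 ≤ t → t ≤ s → FiberPowers.IsKoszulIdeal (J ^ t)) →
      ∀ t, 1 ≤ t → t ≤ s →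
        G t = G (t - 1) + (𝔪 * 𝔫) ^ (s - t) * J' ^ t ∧
        FiberPowers.BettiNumbersSplit k (𝔪 + 𝔫) (G t) (G (t - 1)) ((𝔪 * 𝔫) ^ (s - t) * J' ^ t) ∧
        (J ≠ ⊥ → FiberPowers.IsBettiSplitting k (𝔪 + 𝔫)
          (G t) (G (t - 1)) ((𝔪 * 𝔫) ^ (s - t) * J' ^ t))) := by
  intro 𝔪 𝔫 J' G
  have h1 := FiberPowers.fiberProduct_pow_eq (I := FiberPowers.extLeft τ I)
    (J := FiberPowers.extRight σ J) (𝔪 := FiberPowers.maxLeft k σ τ)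
    (𝔫 := FiberPowers.maxRight k σ τ) (FiberPowers.extLeft_le_maxLeft_sq hI2)
    (FiberPowers.extRight_le_maxRight_sq hJ2) s
  refine ⟨h1, fun t ht hts => ?_, fun hc t ht hts => ?_⟩
  · obtain ⟨t, rfl⟩ := Nat.exists_eq_add_of_le' ht
    refine (FiberPowers.idealG_inf hI2 hJ2 (Nat.sub_add_cancel hts)).trans ?_
    rw [← FiberPowers.pow_mul_extRight_pow]
    exact (mul_assoc _ _ _).symm
  · obtain ⟨t, rfl⟩ := Nat.exists_eq_add_of_le' ht
    -- After the shift `t ↦ t + 1`, the power involved is `J^t`; for `t = 0` it is the unit ideal,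
    -- about which (iii) says nothing, so that case is kept as a separate alternative.
    have hc' : CharZero k ∨ FiberPowers.IsMonomialIdeal J ∨ t = 0 ∨
        FiberPowers.IsKoszulIdeal (J ^ t) :=
      hc.imp_right (Or.imp_right fun h => t.eq_zero_or_pos.imp_right fun h0 =>
        h t h0 (by omega))
    exact ⟨FiberPowers.idealG_succ s t,
      FiberPowers.bettiNumbersSplit_idealG hJ hI2 hJ2 (Nat.sub_add_cancel hts) hc',
      FiberPowers.isBettiSplitting_idealG hJ hI2 hJ2 (Nat.sub_add_cancel hts) hc'⟩
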